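/- Let $n\ge 2$ and $k\ge 1$ be integers. Let $\mu_n$ be the probability measure $d\mu_n(t)=\gamma_n(1-t^2)^{(n-3)/2}\,dt$ on $[-1,1]$, and let $P_i=P_i^{(n)}$, $i\ge 0$, be the Gegenbauer polynomials: $\deg P_i=i$, $P_i(1)=1$, $\int P_iP_j\,d\mu_n=0$ for $i\neq j$. The $i$-th Gegenbauer coefficient of a polynomial $f$ is $\int fP_i\,d\mu_n/\int P_i^2\,d\mu_n$. For a set $T$ of positive integers put $\mathcal P_T=\mathrm{span}\{P_i: i\in T\cup\{0\}\}$, and write $\mathcal P_m$ for the space of real polynomials of degree at most $m$. A function $h:[-1,1]\to[0,\infty]$ is called absolutely monotone if it is finite and smooth on $[-1,1)$ with all derivatives $h^{(m)}\ge 0$ there, $m\ge 0$, and is nondecreasing on $[-1,1]$ (so $h(1)$ may be $+\infty$). Let $\mathcal L(n,T,h)$ be the set of $f\in\mathcal P_T$ with $f(t)\le h(t)$ for all $t\in[-1,1]$. The space $\mathcal P_T$ is a PULB-space for dimension $n$ if there are finitely many distinct nodes $\alpha_1,\dots,\alpha_\ell\in[-1,1]$ and weights $\rho_1,\dots,\rho_\ell>0$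 such that (i) $\int f\,d\mu_n=\sum_{i=1}^{\ell}\rho_if(\alpha_i)$ for all $f\in\mathcal P_T$; (ii) for every absolutely monotone $h$ there is $f\in\mathcal L(n,T,h)$ with $f(\alpha_i)=h(\alpha_i)$ for $i=1,\dots,\ell$. Let $T^k=\{1,\dots,2k+2\}\setminus\{2k\}$. Then $$\mathcal P_{T^k}=\mathcal P_{2k-1}\oplus\mathrm{span}\,(P_{2k+1},P_{2k+2}),$$ and $\mathcal P_{T^k}$ is a PULB-space for dimension $n$. Suppose moreover that $n\ge 3$, and let $\alpha=n/2-1$. Then the system $$bc=-\frac{(k+1)k(\alpha+k-1)}{(2\alpha+k)(2\alpha+k-1)(\alpha+k+1)},\qquad b+c=-\frac{2\alpha(k+1)^2(\alpha+k-1)}{(2\alpha+k)(2\alpha+k-1)(\alpha+2k+1)}$$ has exactly one real solution $(b,c)$ with $b>0>c$. For this $b$ there are $-1<\beta_1<\dots<\beta_{k+1}<1$, symmetric about the origin ($\beta_{k+2-i}=-\beta_i$), such that $$q_{k+1}(t):=P_{k+1}(t)+bP_{k-1}(t)=\frac{(\alpha)_{k+1}2^{k+1}}{(2\alpha)_{k+1}}\prod_{i=1}^{k+1}(t-\beta_i),$$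 where $(x)_m=x(x+1)\cdots(x+m-1)$. There are weights $\gamma_1,\dots,\gamma_{k+1}>0$ with $\int f\,d\mu_n=\sum_{i=1}^{k+1}\gamma_if(\beta_i)$ for all $f\in\mathcal P_{T^k}$. The Gegenbauer coefficients of $(t-\beta_1)\cdots(t-\beta_k)$ of indices $0,1,\dots,k$ are all positive. Finally, for every absolutely monotone $h$ there is $f\in\mathcal L(n,T^k,h)$ with $f(\beta_i)=h(\beta_i)$ for $i=1,\dots,k+1$. -/

import Mathlib

open MeasureTheory Polynomial Set
open scoped ENNReal

noncomputable section

namespace SkipOneAddTwo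

/-! ### The Gegenbauer measure and the Gegenbauer polynomials -/

/-- The unnormalized Gegenbauer weight `(1 - t²)^((n-3)/2)`. -/
def weight (n : ℕ) (t : ℝ) : ℝ := (1 - t ^ 2) ^ (((n : ℝ) - 3) / 2)

/-- The measure `dμ_n(t) = γ_n (1 - t²)^((n-3)/2) dt` on `[-1, 1]`, where the constant `γ_n` is
chosen so that the total mass is one. -/
def gegenbauerMeasure (n : ℕ) : Measure ℝ :=
  (volume.restrict (Icc (-1 : ℝ) 1)).withDensity
    (fun t => ENNReal.ofReal ((∫ s in Icc (-1 : ℝ) 1, weight n s)⁻¹ * weight n t))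

/-- The Gegenbauer polynomials `P_i^{(n)}`, normalized by `P_i^{(n)}(1) = 1`, through their
three-term recurrence
`(i + n - 1) P_{i+2} = (2 i + n) t P_{i+1} - (i + 1) P_i`.
For `n ≥ 2` they are the polynomials of degree `i` that are orthogonal with respect to `μ_n` and
take the value one at `1`; see `natDegree_gegenbauer`, `gegenbauer_eval_one` and
`gegenbauer_orthogonal`. -/
def gegenbauer (n : ℕ) : ℕ → ℝ[X]
  | 0 => 1
  | 1 => X
  | i + 2 => C (((i : ℝ) + n - 1)⁻¹) *
      (C (2 * (i : ℝ) + n) * X * gegenbauer n (i + 1) - C ((i : ℝ) + 1) * gegenbauer n i)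

/-- The Gegenbauer coefficient `f_i = ∫ f P_i dμ_n / ‖P_i‖²`. -/
def gegenbauerCoeff (n : ℕ) (f : ℝ[X]) (i : ℕ) : ℝ :=
  (∫ t, f.eval t * (gegenbauer n i).eval t ∂gegenbauerMeasure n) /
    ∫ t, (gegenbauer n i).eval t ^ 2 ∂gegenbauerMeasure n

/-- `P_T = span {P_i^{(n)} : i ∈ T ∪ {0}}`. -/
def gegenbauerSpace (n : ℕ) (T : Set ℕ) : Submodule ℝ ℝ[X] :=
  Submodule.span ℝ (gegenbauer n '' (T ∪ {0}))

/-- The index set `T^k = {1, …, 2k+2} \ {2k}`. -/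
def skipOneAddTwo (k : ℕ) : Set ℕ := Icc 1 (2 * k + 2) \ {2 * k}

/-! ### Potentials, admissible polynomials, quadrature rules, PULB-spaces -/

/-- A potential `h : [-1,1] → [0,∞]` is absolutely monotone if it is finite and absolutely
monotone (smooth, with all derivatives nonnegative) on `[-1,1)`, and nondecreasing up to the
endpoint `1`, where it may be infinite. Values outside `[-1,1]` play no role. -/
structure IsAbsolutelyMonotonePotential (h : ℝ → ℝ≥0∞) : Prop where
  finite : ∀ t ∈ Ico (-1 : ℝ) 1, h t ≠ ∞
  absolutelyMonotoneOn : AbsolutelyMonotoneOn (fun t => (h t).toReal) (Ico (-1 : ℝ) 1)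
  monotoneOn : MonotoneOn h (Icc (-1 : ℝ) 1)

/-- The class `L(n,T,h)` of lower admissible polynomials: `f ∈ P_T` with `f ≤ h` on `[-1,1]`. -/
def lowerAdmissible (n : ℕ) (T : Set ℕ) (h : ℝ → ℝ≥0∞) : Set ℝ[X] :=
  {f | f ∈ gegenbauerSpace n T ∧
    ∀ t ∈ Icc (-1 : ℝ) 1, ((f.eval t : ℝ) : EReal) ≤ ((h t : ℝ≥0∞) : EReal)}

/-- The distinct nodes `α i ∈ [-1,1]` with the positive weights `ρ i` form a quadrature rule for
`μ_n` that is exact on `P_T`. -/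
structure IsPositiveQuadrature (n : ℕ) (T : Set ℕ) {l : ℕ} (α ρ : Fin l → ℝ) : Prop where
  injective : Function.Injective α
  mem_Icc : ∀ i, α i ∈ Icc (-1 : ℝ) 1
  pos : ∀ i, 0 < ρ i
  exact : ∀ f ∈ gegenbauerSpace n T,
    ∫ t, f.eval t ∂gegenbauerMeasure n = ∑ i, ρ i * f.eval (α i)

/-- Every absolutely monotone potential `h` has a lower admissible polynomial `f ∈ L(n,T,h)` that
agrees with `h` at the nodes `α i`. -/
def HasLowerInterpolants (n : ℕ) (T : Set ℕ) {l : ℕ} (α : Fin l → ℝ) : Prop :=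
  ∀ h : ℝ → ℝ≥0∞, IsAbsolutelyMonotonePotential h →
    ∃ f ∈ lowerAdmissible n T h, ∀ i, ((f.eval (α i) : ℝ) : EReal) = ((h (α i) : ℝ≥0∞) : EReal)

/-- `P_T` is a PULB-space for dimension `n`. -/
def IsPULBSpace (n : ℕ) (T : Set ℕ) : Prop :=
  ∃ (l : ℕ) (α ρ : Fin l → ℝ), IsPositiveQuadrature n T α ρ ∧ HasLowerInterpolants n T α

/-- The system for the unknowns `b` and `c`, where `a = n/2 - 1`. -/
def IsSystemSolution (n k : ℕ) (b c : ℝ) : Prop :=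
  let a : ℝ := (n : ℝ) / 2 - 1
  b * c = -((k + 1) * k * (a + k - 1)) /
      ((2 * a + k) * (2 * a + k - 1) * (a + k + 1)) ∧
  b + c = -(2 * a * (k + 1) ^ 2 * (a + k - 1)) /
      ((2 * a + k) * (2 * a + k - 1) * (a + 2 * k + 1))

/-! ### The normalization and the orthogonality of the Gegenbauer polynomials -/

theorem gegenbauer_rec {n : ℕ} (hn : 2 ≤ n) (i : ℕ) :
    ((i : ℝ[X]) + (n : ℝ[X]) - 1) * gegenbauer n (i + 2) =
      (2 * (i : ℝ[X]) + (n : ℝ[X])) * X * gegenbauer n (i + 1) - ((i : ℝ[X]) + 1) * gegenbauer n i := by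
  have h0 : ((i : ℝ) + n - 1) ≠ 0 := by
    have : (2 : ℝ) ≤ n := by exact_mod_cast hn
    have : (0 : ℝ) ≤ i := Nat.cast_nonneg i
    linarith
  have h1 : ((i : ℝ[X]) + (n : ℝ[X]) - 1) * C (((i : ℝ) + n - 1)⁻¹) = 1 := by
    have : ((i : ℝ[X]) + (n : ℝ[X]) - 1) = C ((i : ℝ) + n - 1) := by simp
    rw [this, ← C_mul, mul_inv_cancel₀ h0, C_1]
  rw [gegenbauer, ← mul_assoc, h1, one_mul]
  simp only [map_add, map_mul, map_natCast, map_ofNat, C_1]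

theorem gegenbauer_eval_one {n : ℕ} (hn : 2 ≤ n) (i : ℕ) : (gegenbauer n i).eval 1 = 1 := by
  induction i using Nat.twoStepInduction with
  | zero => simp [gegenbauer]
  | one => simp [gegenbauer]
  | more i h0 h1 =>
    have h := congrArg (eval 1) (gegenbauer_rec hn i)
    simp only [eval_mul, eval_add, eval_sub, eval_natCast, eval_one, eval_X, eval_ofNat,
      h0, h1] at h
    have : (2 : ℝ) ≤ n := by exact_mod_cast hn
    have hi : (0 : ℝ) ≤ i := Nat.cast_nonneg i
    have h2 : ((i : ℝ) + n - 1) ≠ 0 := by linarith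
    apply mul_left_cancel₀ h2
    linarith

theorem natDegree_gegenbauer {n : ℕ} (hn : 2 ≤ n) (i : ℕ) : (gegenbauer n i).natDegree = i := by
  have hn' : (2 : ℝ) ≤ n := by exact_mod_cast hn
  induction i using Nat.twoStepInduction with
  | zero => simp [gegenbauer]
  | one => simp [gegenbauer]
  | more i h0 h1 =>
    have hi : (0 : ℝ) ≤ i := Nat.cast_nonneg i
    have hne : gegenbauer n (i + 1) ≠ 0 := by
      intro h
      rw [h] at h1
      simp at h1
    have hd : (C (2 * (i : ℝ) + n) * X * gegenbauer n (i + 1)).natDegree = i + 2 := by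
      rw [mul_assoc, natDegree_C_mul (by linarith), natDegree_X_mul hne, h1]
    rw [gegenbauer, natDegree_C_mul (inv_ne_zero (by linarith)),
      natDegree_sub_eq_left_of_natDegree_lt, hd]
    rw [hd]
    refine lt_of_le_of_lt (natDegree_C_mul_le _ _) ?_
    omega

theorem gegenbauer_derivative {n : ℕ} (hn : 2 ≤ n) (i : ℕ) :
    (1 - X ^ 2) * derivative (gegenbauer n i) =
      ((i : ℝ[X]) + (n : ℝ[X]) - 2) * (X * gegenbauer n i - gegenbauer n (i + 1)) := by
  induction i using Nat.twoStepInduction with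
  | zero => simp [gegenbauer]
  | one =>
    have h := gegenbauer_rec hn 0
    simp only [gegenbauer] at h ⊢
    simp only [derivative_X, Nat.cast_zero, Nat.cast_one, zero_add] at h ⊢
    linear_combination h
  | more i h0 h1 =>
    have hr := gegenbauer_rec hn i
    have hr' := gegenbauer_rec hn (i + 1)
    have hd := congrArg derivative hr
    simp only [derivative_mul, derivative_sub, derivative_add, derivative_natCast, derivative_X,
      derivative_one, derivative_ofNat] at hd
    push_cast at *
    have h2 : ((i : ℝ[X]) + (n : ℝ[X]) - 1) ≠ 0 := by
      have : ((i : ℝ[X]) + (n : ℝ[X]) - 1) = C ((i : ℝ) + n - 1) := by simp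
      rw [this, Ne, C_eq_zero]
      have : (2 : ℝ) ≤ n := by exact_mod_cast hn
      have hi : (0 : ℝ) ≤ i := Nat.cast_nonneg i
      linarith
    apply mul_left_cancel₀ h2
    linear_combination (1 - X ^ 2) * hd + (2 * (i : ℝ[X]) + (n : ℝ[X])) * X * h1
      - ((i : ℝ[X]) + 1) * h0 + ((i : ℝ[X]) + (n : ℝ[X]) - 1) * hr' - ((i : ℝ[X]) + (n : ℝ[X]) - 2) * X * hr

theorem weight_nonneg {n : ℕ} {t : ℝ} (ht : t ∈ Icc (-1 : ℝ) 1) : 0 ≤ weight n t :=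
  Real.rpow_nonneg (by nlinarith [ht.1, ht.2]) _

theorem measurable_weight (n : ℕ) : Measurable (weight n) := by
  unfold weight
  fun_prop

theorem integrableOn_weight {n : ℕ} (hn : 2 ≤ n) : IntegrableOn (weight n) (Icc (-1 : ℝ) 1) := by
  have hn' : (2 : ℝ) ≤ n := by exact_mod_cast hn
  have h := Polynomial.Chebyshev.intervalIntegrable_sqrt_one_sub_sq_inv
  rw [intervalIntegrable_iff, Set.uIoc_of_le (by norm_num), integrableOn_Ioc_iff_integrableOn_Ioo]
    at h
  rw [integrableOn_Icc_iff_integrableOn_Ioo]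
  refine Integrable.mono' h (measurable_weight n).aestronglyMeasurable ?_
  refine (ae_restrict_iff' measurableSet_Ioo).2 (Filter.Eventually.of_forall fun t ht => ?_)
  have h1 : 0 < 1 - t ^ 2 := by nlinarith [ht.1, ht.2]
  rw [Real.norm_of_nonneg (weight_nonneg ⟨ht.1.le, ht.2.le⟩), Real.sqrt_inv, Real.sqrt_eq_rpow,
    ← Real.rpow_neg h1.le, weight]
  exact Real.rpow_le_rpow_of_exponent_ge h1 (by nlinarith [sq_nonneg t]) (by linarith)

theorem integral_weight_pos {n : ℕ} (hn : 2 ≤ n) : 0 < ∫ s in Icc (-1 : ℝ) 1, weight n s := by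
  rw [setIntegral_pos_iff_support_of_nonneg_ae]
  · refine lt_of_lt_of_le ?_ (measure_mono (s := Ioo (-1 : ℝ) 1) ?_)
    · simp
    · intro t ht
      refine ⟨?_, ht.1.le, ht.2.le⟩
      have h1 : 0 < 1 - t ^ 2 := by nlinarith [ht.1, ht.2]
      exact (Real.rpow_pos_of_pos h1 _).ne'
  · exact (ae_restrict_iff' measurableSet_Icc).2
      (Filter.Eventually.of_forall fun t ht => weight_nonneg ht)
  · exact integrableOn_weight hn

theorem integral_gegenbauerMeasure {n : ℕ} (hn : 2 ≤ n) (f : ℝ → ℝ) :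
    ∫ t, f t ∂gegenbauerMeasure n =
      (∫ s in Icc (-1 : ℝ) 1, weight n s)⁻¹ * ∫ t in Icc (-1 : ℝ) 1, weight n t * f t := by
  rw [gegenbauerMeasure, integral_withDensity_eq_integral_toReal_smul
    ((measurable_weight n).const_mul _).ennreal_ofReal (by simp), ← integral_const_mul]
  refine setIntegral_congr_fun measurableSet_Icc fun t ht => ?_
  have := mul_nonneg (inv_nonneg.2 (integral_weight_pos hn).le) (weight_nonneg (n := n) ht)
  simp only [ENNReal.toReal_ofReal this, smul_eq_mul, mul_assoc]

theorem isProbabilityMeasure_gegenbauerMeasure {n : ℕ} (hn : 2 ≤ n) :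
    IsProbabilityMeasure (gegenbauerMeasure n) := by
  constructor
  rw [gegenbauerMeasure, withDensity_apply _ MeasurableSet.univ, Measure.restrict_univ,
    ← ofReal_integral_eq_lintegral_ofReal, integral_const_mul,
    inv_mul_cancel₀ (integral_weight_pos hn).ne', ENNReal.ofReal_one]
  · exact (integrableOn_weight hn).const_mul _
  · exact (ae_restrict_iff' measurableSet_Icc).2 (Filter.Eventually.of_forall fun t ht =>
      mul_nonneg (inv_nonneg.2 (integral_weight_pos hn).le) (weight_nonneg ht))

theorem integrable_weight_mul_eval {n : ℕ} (hn : 2 ≤ n) (p : ℝ[X]) :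
    IntegrableOn (fun t => weight n t * p.eval t) (Icc (-1 : ℝ) 1) :=
  (integrableOn_weight hn).mul_continuousOn p.continuous.continuousOn isCompact_Icc

/-- Integration of polynomials against the weight, as a linear functional. -/
def weightIntegral {n : ℕ} (hn : 2 ≤ n) : ℝ[X] →ₗ[ℝ] ℝ where
  toFun p := ∫ t in Icc (-1 : ℝ) 1, weight n t * p.eval t
  map_add' p q := by
    rw [← integral_add (integrable_weight_mul_eval hn p) (integrable_weight_mul_eval hn q)]
    simp [mul_add]
  map_smul' c p := by
    simp only [eval_smul, smul_eq_mul, RingHom.id_apply]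
    rw [← integral_const_mul]
    simp [mul_left_comm]

theorem weightIntegral_by_parts {n : ℕ} (hn : 2 ≤ n) (p : ℝ[X]) :
    weightIntegral hn ((1 - X ^ 2) * derivative p - C ((n : ℝ) - 1) * (X * p)) = 0 := by
  have hn' : (2 : ℝ) ≤ n := by exact_mod_cast hn
  have h := intervalIntegral.integral_eq_sub_of_hasDerivAt_of_le (a := -1) (b := 1) (by norm_num)
    (f := fun t => (1 - t ^ 2) ^ (((n : ℝ) - 1) / 2) * p.eval t)
    (f' := fun t => weight n t *
      ((1 - X ^ 2) * derivative p - C ((n : ℝ) - 1) * (X * p)).eval t) ?_ ?_ ?_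
  · have h0 : ((n : ℝ) - 1) / 2 ≠ 0 := by linarith
    rw [intervalIntegral.integral_of_le (by norm_num), ← integral_Icc_eq_integral_Ioc] at h
    simpa only [weightIntegral, LinearMap.coe_mk, AddHom.coe_mk, one_pow, even_two, Even.neg_pow,
      sub_self, Real.zero_rpow h0, zero_mul] using h
  · refine ContinuousOn.mul (ContinuousOn.rpow_const (by fun_prop) ?_) p.continuous.continuousOn
    intro t _
    exact Or.inr (by linarith)
  · intro t ht
    have h1 : 0 < 1 - t ^ 2 := by nlinarith [ht.1, ht.2]
    have h2 : HasDerivAt (fun t : ℝ => 1 - t ^ 2) (-(2 * t)) t := by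
      simpa using (hasDerivAt_pow 2 t).const_sub 1
    have h3 := (h2.rpow_const (p := ((n : ℝ) - 1) / 2) (Or.inl h1.ne')).mul (p.hasDerivAt t)
    refine h3.congr_deriv ?_
    have e1 : ((n : ℝ) - 1) / 2 - 1 = ((n : ℝ) - 3) / 2 := by ring
    have e2 : (1 - t ^ 2) ^ (((n : ℝ) - 1) / 2) = (1 - t ^ 2) ^ (((n : ℝ) - 3) / 2) * (1 - t ^ 2) := by
      rw [← Real.rpow_add_one h1.ne']
      congr 1
      ring
    rw [e1, e2]
    simp [weight]
    ring
  · rw [intervalIntegrable_iff, Set.uIoc_of_le (by norm_num)]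
    exact (integrable_weight_mul_eval hn _).mono_set Ioc_subset_Icc_self

theorem weightIntegral_gegenbauer_mul {n : ℕ} (hn : 2 ≤ n) (k : ℕ) :
    ∀ j ≤ k, weightIntegral hn (gegenbauer n j * gegenbauer n (k + 1)) = 0 := by
  have hn' : (2 : ℝ) ≤ n := by exact_mod_cast hn
  have hC : ∀ c p, weightIntegral hn (C c * p) = c * weightIntegral hn p := by
    intro c p
    rw [C_mul', map_smul, smul_eq_mul]
  have hparts : ∀ i j : ℕ, weightIntegral hn
      (gegenbauer n j * (C ((i : ℝ) + n - 2) * (X * gegenbauer n i - gegenbauer n (i + 1))) +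
      (C ((j : ℝ) + n - 2) * (X * gegenbauer n j - gegenbauer n (j + 1))) * gegenbauer n i
      - C ((n : ℝ) - 1) * (X * (gegenbauer n j * gegenbauer n i))) = 0 := by
    intro i j
    rw [← weightIntegral_by_parts hn (gegenbauer n j * gegenbauer n i), derivative_mul]
    have hi := gegenbauer_derivative hn i
    have hj := gegenbauer_derivative hn j
    congr 1
    simp only [map_add, map_sub, map_natCast, map_ofNat]
    linear_combination (-gegenbauer n j) * hi - gegenbauer n i * hj
  have hlin : ∀ i j : ℕ, ((i : ℝ) + n - 2) *
        (weightIntegral hn (X * (gegenbauer n j * gegenbauer n i))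
          - weightIntegral hn (gegenbauer n j * gegenbauer n (i + 1)))
      + ((j : ℝ) + n - 2) * (weightIntegral hn (X * (gegenbauer n j * gegenbauer n i))
          - weightIntegral hn (gegenbauer n (j + 1) * gegenbauer n i))
      - ((n : ℝ) - 1) * weightIntegral hn (X * (gegenbauer n j * gegenbauer n i)) = 0 := by
    intro i j
    rw [← hparts i j]
    simp only [← hC, ← map_sub, ← map_add]
    congr 1
    ring
  have hrec : ∀ i j : ℕ, ((i : ℝ) + n - 1) *
        weightIntegral hn (gegenbauer n (i + 2) * gegenbauer n j) =
      (2 * (i : ℝ) + n) * weightIntegral hn (X * (gegenbauer n (i + 1) * gegenbauer n j))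
      - ((i : ℝ) + 1) * weightIntegral hn (gegenbauer n i * gegenbauer n j) := by
    intro i j
    simp only [← hC, ← map_sub]
    congr 1
    have := gegenbauer_rec hn i
    simp only [map_add, map_sub, map_natCast, map_mul, map_ofNat, C_1]
    linear_combination gegenbauer n j * this
  have hcomm : ∀ i j : ℕ, weightIntegral hn (gegenbauer n i * gegenbauer n j) =
      weightIntegral hn (gegenbauer n j * gegenbauer n i) := fun i j => by rw [mul_comm]
  induction k with
  | zero =>
    intro j hj
    obtain rfl : j = 0 := by omega
    have h := weightIntegral_by_parts hn 1
    rw [derivative_one, mul_zero, zero_sub, map_neg, hC, neg_eq_zero] at h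
    simpa [gegenbauer, (show ((n : ℝ) - 1) ≠ 0 by linarith)] using h
  | succ m ih =>
    intro j hj
    have hm : (0 : ℝ) ≤ m := Nat.cast_nonneg m
    rcases Nat.lt_or_ge m j with hmj | hjm
    · obtain rfl : j = m + 1 := by omega
      have h1 := hlin (m + 1) (m + 1)
      have h2 := hrec m (m + 1)
      rw [ih m le_rfl] at h2
      rw [hcomm (m + 1 + 1) (m + 1)] at h1
      rw [hcomm (m + 2) (m + 1)] at h2
      push_cast at h1
      rw [show m + 1 + 1 = m + 2 from rfl] at h1 ⊢
      generalize weightIntegral hn (X * (gegenbauer n (m + 1) * gegenbauer n (m + 1))) = x at h1 h2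
      generalize weightIntegral hn (gegenbauer n (m + 1) * gegenbauer n (m + 2)) = y at h1 h2 ⊢
      have hx : (2 * (m : ℝ) + n + 1) * x = 0 := by linear_combination -h1 - 2 * h2
      have hx0 : x = 0 := by
        rcases mul_eq_zero.1 hx with h | h
        · linarith
        · exact h
      rw [hx0] at h2
      rcases mul_eq_zero.1 (show ((m : ℝ) + n - 1) * y = 0 by linarith) with h | h
      · linarith
      · exact h
    · have hx : ((m : ℝ) - j) *
          weightIntegral hn (X * (gegenbauer n j * gegenbauer n (m + 1))) = 0 := by
        rcases eq_or_lt_of_le hjm with rfl | hlt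
        · simp
        · rcases j with _ | i
          · have := ih 1 (by omega)
            simp only [gegenbauer, one_mul] at this ⊢
            rw [this, mul_zero]
          · have h2 := hrec i (m + 1)
            rw [ih i (by omega), ih (i + 2) (by omega)] at h2
            have hi : (0 : ℝ) ≤ i := Nat.cast_nonneg i
            rcases mul_eq_zero.1 (show (2 * (i : ℝ) + n) *
              weightIntegral hn (X * (gegenbauer n (i + 1) * gegenbauer n (m + 1))) = 0 by
                linarith) with h | h
            · linarith
            · rw [h, mul_zero]
      have hz : ((j : ℝ) + n - 2) *
          weightIntegral hn (gegenbauer n (j + 1) * gegenbauer n (m + 1)) =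
          (2 * (j : ℝ) + n - 2) *
          weightIntegral hn (X * (gegenbauer n j * gegenbauer n (m + 1))) := by
        rcases j with _ | i
        · simp [gegenbauer]
        · have h2 := hrec i (m + 1)
          rw [ih i (by omega)] at h2
          push_cast
          rw [show i + 1 + 1 = i + 2 from rfl]
          linear_combination h2
      have h1 := hlin (m + 1) j
      push_cast at h1
      rcases mul_eq_zero.1 (show ((m : ℝ) + n - 1) *
          weightIntegral hn (gegenbauer n j * gegenbauer n (m + 1 + 1)) = 0 by
        linear_combination hx - hz - h1) with h | h
      · linarith
      · exact h

theorem gegenbauer_orthogonal {n : ℕ} (hn : 2 ≤ n) {i j : ℕ} (hij : i ≠ j) :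
    ∫ t, (gegenbauer n i).eval t * (gegenbauer n j).eval t ∂gegenbauerMeasure n = 0 := by
  have key : ∀ i j : ℕ, i < j →
      ∫ t, (gegenbauer n i).eval t * (gegenbauer n j).eval t ∂gegenbauerMeasure n = 0 := by
    intro i j hij
    obtain ⟨k, rfl⟩ : ∃ k, j = k + 1 := ⟨j - 1, by omega⟩
    rw [integral_gegenbauerMeasure hn]
    have h := weightIntegral_gegenbauer_mul hn k i (by omega)
    simp only [weightIntegral, LinearMap.coe_mk, AddHom.coe_mk, eval_mul] at h
    rw [h, mul_zero]
  rcases lt_or_gt_of_ne hij with h | h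
  · exact key i j h
  · simpa only [mul_comm] using key j i h

end SkipOneAddTwo

end

open SkipOneAddTwo

noncomputable section

namespace SkipOneAddTwo

/-! ### Rolle's theorem for several zeros -/

/-! Write q_b = P_{k+1} + b P_{k-1}, and call the mean of P_{2k} f the P_{2k} component of f (up to
a positive factor it is the Gegenbauer coefficient). The lemmas on q_b use m = k - 1.

Quadrature. Interpolatory weights at the k+1 zeros of q_b give an error functional that vanishes on
q_b g + r whenever deg r ≤ k and q_b g has mean zero. Since q_b is orthogonal to all degrees below
k-1, the error vanishes in degrees below 2k. Modulo these, the space is two-dimensional, so two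
further test polynomials suffice (`gegenbauerSpace_le_ker`). One is q_b P_k, which is odd of degree
2k+1. The other is q_b q_c: the equation for bc says that its mean is zero, and the equation for b +
c says that its P_{2k} component is zero. `IsSkipPair` records these two conditions in terms of
norms and leading coefficients.

Zeros and positivity. At a zero of P_k the recurrence makes P_{k+1} equal to -k/(2α+k) times
P_{k-1}. Hence for 0 ≤ b < k/(2α+k) the values of q_b keep the signs of P_{k+1}, its zeros interlace
with those of P_k, and a Christoffel-type identity (`mean_christoffel_pos`) makes the weights
positive. The bound on b comes from evaluating (x-b)(x-c) at k/(2α+k) (`lt_of_vieta`). The same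
identity at the largest node gives the positive Gegenbauer coefficients.

Lower interpolants. Let H be the Hermite interpolant of h, to first order at each node; it has
degree at most 2k+1 and stays below h by the usual error formula. Its only defect is its P_{2k}
component, which is nonnegative: this reduces to the coefficient of t^{2k}, where symmetry of the
nodes enters (`NonnegDerivatives.exists_lower_hermite_interpolant`). Since b > c, comparison with
q_b q_c shows that q_b² has positive P_{2k} component. Subtracting the right nonnegative multiple of
q_b² therefore lands in the space, keeps the values at the nodes, and only lowers the polynomial.

The circle. For n = 2 and k ≥ 2 the system would give b = 1, where the bound on b is an equality.
The k zeros of P_k serve instead, and H already has degree below 2k. For n = 2 and k = 1 the pair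
±1/√2 is checked directly. -/

/-- The zeros given by Rolle lie strictly between consecutive points of `S`, hence off `S`;
disjointness later allows double zeros to be counted in addition. The clause `∃ y ∈ S, x < y` keeps
the old zeros below the maximum of `S`, so that the one found beyond it in the induction step is
new. -/
theorem exists_finset_zeros_deriv {f f' : ℝ → ℝ} {a b : ℝ}
    (hf : ∀ x ∈ Ioo a b, HasDerivAt f (f' x) x) (S : Finset ℝ) :
    (∀ x ∈ S, x ∈ Ioo a b ∧ f x = 0) → ∃ S' : Finset ℝ, S.card ≤ S'.card + 1 ∧ Disjoint S S' ∧
      ∀ x ∈ S', (x ∈ Ioo a b ∧ f' x = 0) ∧ ∃ y ∈ S, x < y := by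
  induction S using Finset.induction_on_max with
  | empty => exact fun _ => ⟨∅, by simp⟩
  | insert c S hc ih =>
    intro hS
    have hcS : c ∉ S := fun h => (hc c h).false
    obtain ⟨S', h1, h2, h3⟩ := ih fun x hx => hS x (Finset.mem_insert_of_mem hx)
    rcases S.eq_empty_or_nonempty with rfl | hne
    · exact ⟨∅, by simp⟩
    set m := S.max' hne with hm
    have hmS : m ∈ S := S.max'_mem hne
    have hmc : m < c := hc m hmS
    have hma := (hS m (Finset.mem_insert_of_mem hmS))
    have hca := hS c (Finset.mem_insert_self _ _)
    have hsub : ∀ x ∈ Icc m c, x ∈ Ioo a b := fun x hx =>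
      ⟨lt_of_lt_of_le hma.1.1 hx.1, lt_of_le_of_lt hx.2 hca.1.2⟩
    obtain ⟨z, hz, hz0⟩ := exists_hasDerivAt_eq_zero hmc
      (fun x hx => (hf x (hsub x hx)).continuousAt.continuousWithinAt) (hma.2.trans hca.2.symm)
      (fun x hx => hf x (hsub x (Ioo_subset_Icc_self hx)))
    have hlt : ∀ x ∈ S', x < m := fun x hx => by
      obtain ⟨y, hy, hxy⟩ := (h3 x hx).2
      exact lt_of_lt_of_le hxy (S.le_max' y hy)
    have hzS' : z ∉ S' := fun h => (hz.1.trans (hlt z h)).false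
    refine ⟨insert z S', ?_, ?_, ?_⟩
    · rw [Finset.card_insert_of_notMem hcS, Finset.card_insert_of_notMem hzS']
      omega
    · rw [Finset.disjoint_insert_left, Finset.disjoint_insert_right]
      refine ⟨?_, ?_, h2⟩
      · rw [Finset.mem_insert, not_or]
        exact ⟨hz.2.ne', fun h => ((hlt c h).trans hmc).false⟩
      · exact fun h => (hz.1.trans_le (S.le_max' z h)).false
    · intro x hx
      rcases Finset.mem_insert.1 hx with rfl | hx
      · exact ⟨⟨hsub x (Ioo_subset_Icc_self hz), hz0⟩, c, Finset.mem_insert_self _ _, hz.2⟩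
      · obtain ⟨y, hy, hxy⟩ := (h3 x hx).2
        exact ⟨(h3 x hx).1, y, Finset.mem_insert_of_mem hy, hxy⟩

theorem exists_zero_of_card_zeros {a b : ℝ} (m : ℕ) : ∀ (F : ℕ → ℝ → ℝ),
    (∀ i, ∀ x ∈ Ioo a b, HasDerivAt (F i) (F (i + 1) x) x) → ∀ S : Finset ℝ,
    (∀ x ∈ S, x ∈ Ioo a b ∧ F 0 x = 0) → m + 1 ≤ S.card → ∃ x ∈ Ioo a b, F m x = 0 := by
  induction m with
  | zero =>
    intro F _ S hS hc
    obtain ⟨x, hx⟩ := Finset.card_pos.1 (show 0 < S.card by omega)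
    exact ⟨x, hS x hx⟩
  | succ m ih =>
    intro F hF S hS hc
    obtain ⟨S', h1, -, h3⟩ := exists_finset_zeros_deriv (hF 0) S hS
    exact ih (fun i => F (i + 1)) (fun i => hF (i + 1)) S' (fun x hx => (h3 x hx).1) (by omega)

theorem exists_zero_of_card_double_zeros {a b : ℝ} (m : ℕ) (F : ℕ → ℝ → ℝ)
    (hF : ∀ i, ∀ x ∈ Ioo a b, HasDerivAt (F i) (F (i + 1) x) x) (S D : Finset ℝ) (hD : D ⊆ S)
    (hS : ∀ x ∈ S, x ∈ Ioo a b ∧ F 0 x = 0) (hD' : ∀ x ∈ D, F 1 x = 0)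
    (hc : m + 2 ≤ S.card + D.card) : ∃ x ∈ Ioo a b, F (m + 1) x = 0 := by
  obtain ⟨S', h1, h2, h3⟩ := exists_finset_zeros_deriv (hF 0) S hS
  -- The zeros of `F 1` are those from Rolle together with the double zeros `D`.
  refine exists_zero_of_card_zeros m (fun i => F (i + 1)) (fun i => hF (i + 1)) (S' ∪ D) ?_ ?_
  · intro x hx
    rcases Finset.mem_union.1 hx with hx | hx
    · exact (h3 x hx).1
    · exact ⟨(hS x (hD hx)).1, hD' x hx⟩
  · rw [Finset.card_union_of_disjoint (Finset.disjoint_of_subset_right hD h2.symm)]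
    omega

/-! ### Hermite interpolation of functions with nonnegative derivatives -/

theorem eval_iterate_derivative_of_natDegree_le {p : ℝ[X]} {m : ℕ} (hp : p.natDegree ≤ m) (x : ℝ) :
    (derivative^[m] p).eval x = m.factorial * p.coeff m := by
  have h : (derivative^[m] p).natDegree ≤ 0 :=
    (natDegree_iterate_derivative p m).trans (by omega)
  rw [eq_C_of_natDegree_le_zero h, eval_C, coeff_iterate_derivative]
  simp [Nat.descFactorial_self]

/-- A function on `(a, b)` with a sequence of successive derivatives, all of them nonnegative. -/
structure NonnegDerivatives (a b : ℝ) (G : ℕ → ℝ → ℝ) : Prop where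
  hasDerivAt : ∀ i, ∀ x ∈ Ioo a b, HasDerivAt (G i) (G (i + 1) x) x
  nonneg : ∀ i, ∀ x ∈ Ioo a b, 0 ≤ G i x

/-- The top coefficient is a divided difference of `G 0` with nodes repeated at most twice. By Rolle
applied to `G 0 - p`, it equals `G (m + 1) x / (m + 1)!` at some intermediate `x`. -/
theorem NonnegDerivatives.coeff_nonneg {a b : ℝ} {G : ℕ → ℝ → ℝ} (hG : NonnegDerivatives a b G)
    {p : ℝ[X]} {m : ℕ} (hp : p.natDegree ≤ m + 1) {S D : Finset ℝ} (hD : D ⊆ S)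
    (hS : ∀ x ∈ S, x ∈ Ioo a b ∧ p.eval x = G 0 x) (hD' : ∀ x ∈ D, p.derivative.eval x = G 1 x)
    (hc : m + 2 ≤ S.card + D.card) : 0 ≤ p.coeff (m + 1) := by
  obtain ⟨x, hx, hx0⟩ := exists_zero_of_card_double_zeros m
    (fun i x => G i x - (derivative^[i] p).eval x)
    (fun i x hx => by
      simp only [Function.iterate_succ_apply']
      exact (hG.hasDerivAt i x hx).sub (Polynomial.hasDerivAt _ x)) S D hD
    (fun x hx => ⟨(hS x hx).1, by simp [(hS x hx).2]⟩)
    (fun x hx => by simp [hD' x hx]) hc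
  have h1 := hG.nonneg (m + 1) x hx
  rw [sub_eq_zero.1 hx0, eval_iterate_derivative_of_natDegree_le hp] at h1
  have h2 : (0 : ℝ) < ((m + 1).factorial : ℝ) := by exact_mod_cast Nat.factorial_pos _
  exact nonneg_of_mul_nonneg_right h1 h2

/-- Correct the Lagrange interpolant `L` of the values by `N * M`, with `N` the nodal polynomial.
This leaves the values alone and changes the derivative at a node by `N' M`, so `M` interpolates the
derivative defect divided by `N'`. -/
theorem exists_hermite_interpolant (S : Finset ℝ) (u v : ℝ → ℝ) :
    ∃ H : ℝ[X], H.degree < ((2 * S.card : ℕ) : WithBot ℕ) ∧ (∀ x ∈ S, H.eval x = u x) ∧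
      ∀ x ∈ S, H.derivative.eval x = v x := by
  classical
  have hinj : Set.InjOn (id : ℝ → ℝ) S := Function.injective_id.injOn
  set N := Lagrange.nodal S id with hN
  set L := Lagrange.interpolate S id u with hL
  set M := Lagrange.interpolate S id
    (fun x => (v x - L.derivative.eval x) / N.derivative.eval x) with hM
  have hL1 : ∀ x ∈ S, L.eval x = u x := fun x hx =>
    Lagrange.eval_interpolate_at_node (v := id) u hinj hx
  have hM1 : ∀ x ∈ S, M.eval x = (v x - L.derivative.eval x) / N.derivative.eval x := fun x hx =>
    Lagrange.eval_interpolate_at_node (v := id) _ hinj hx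
  have hN0 : ∀ x ∈ S, N.eval x = 0 := fun x hx => Lagrange.eval_nodal_at_node (v := id) hx
  have hN1 : ∀ x ∈ S, N.derivative.eval x ≠ 0 := by
    intro x hx
    have h1 := Lagrange.nodalWeight_ne_zero hinj hx
    rw [Lagrange.nodalWeight_eq_eval_derivative_nodal hx] at h1
    exact fun h => h1 (by rw [← hN, id] ; simp [h])
  refine ⟨L + N * M, ?_, ?_, ?_⟩
  · have h1 : L.degree < ((2 * S.card : ℕ) : WithBot ℕ) :=
      (Lagrange.degree_interpolate_lt u hinj).trans_le (by
        exact_mod_cast (by omega : S.card ≤ 2 * S.card))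
    have h2 : (N * M).degree < ((2 * S.card : ℕ) : WithBot ℕ) := by
      rw [degree_mul, hN, Lagrange.degree_nodal]
      have h3 : M.degree < (S.card : WithBot ℕ) := Lagrange.degree_interpolate_lt _ hinj
      rcases eq_or_ne M 0 with h0 | h0
      · rw [h0, degree_zero, WithBot.add_bot]
        exact WithBot.bot_lt_coe _
      · rw [degree_eq_natDegree h0] at h3 ⊢
        have h4 : M.natDegree < S.card := by exact_mod_cast h3
        exact_mod_cast (by omega : S.card + M.natDegree < 2 * S.card)
    exact (degree_add_le _ _).trans_lt (max_lt h1 h2)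
  · intro x hx
    simp [hL1 x hx, hN0 x hx]
  · intro x hx
    simp only [derivative_add, derivative_mul, eval_add, eval_mul, hN0 x hx, hM1 x hx]
    field_simp [hN1 x hx]
    ring

/-- Newton's form explains the coefficient claim: removing the top term `d * N * N'` leaves a
polynomial whose leading coefficient is again a nonnegative divided difference. The removed term
contributes `d * β`, because the nodes sum to zero and `N'` omits only `β`. Taking `β ≥ 0` makes
both contributions nonnegative. -/
theorem NonnegDerivatives.exists_lower_hermite_interpolant {a b : ℝ} {G : ℕ → ℝ → ℝ}
    (hG : NonnegDerivatives a b G) {S : Finset ℝ} (hS : ∀ x ∈ S, x ∈ Ioo a b) (hc : 2 ≤ S.card)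
    (hsum : ∑ x ∈ S, x = 0) {β : ℝ} (hβ : β ∈ S) (hβ0 : 0 ≤ β) :
    ∃ H : ℝ[X], H.natDegree < 2 * S.card ∧ (∀ x ∈ S, H.eval x = G 0 x) ∧
      0 ≤ H.coeff (2 * S.card - 2) ∧ ∀ x ∈ Ioo a b, H.eval x ≤ G 0 x := by
  classical
  obtain ⟨H, hdeg, h0, h1⟩ := exists_hermite_interpolant S (G 0) (G 1)
  have hdeg' : H.natDegree < 2 * S.card := by
    rcases eq_or_ne H 0 with rfl | hH
    · rw [natDegree_zero]
      omega
    · exact (natDegree_lt_iff_degree_lt hH).2 hdeg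
  have hN0 : ∀ x ∈ S, (Lagrange.nodal S id).eval x = 0 := fun x hx =>
    Lagrange.eval_nodal_at_node (v := id) hx
  refine ⟨H, hdeg', h0, ?_, ?_⟩
  · obtain ⟨m, hm⟩ : ∃ m, S.card = m + 2 := ⟨S.card - 2, by omega⟩
    have htop : 0 ≤ H.coeff (2 * m + 3) := by
      have := hG.coeff_nonneg (p := H) (m := 2 * m + 2) (by omega) (Finset.Subset.refl S)
        (fun x hx => ⟨hS x hx, h0 x hx⟩) h1 (by omega)
      exact this
    set d := H.coeff (2 * m + 3) with hd
    set N := Lagrange.nodal S id with hN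
    set N' := Lagrange.nodal (S.erase β) id with hN'
    have hmon : (N * N').Monic := Lagrange.nodal_monic.mul Lagrange.nodal_monic
    have hcard' : (S.erase β).card = m + 1 := by rw [Finset.card_erase_of_mem hβ]; omega
    have hnat : (N * N').natDegree = 2 * m + 3 := by
      rw [Lagrange.nodal_monic.natDegree_mul Lagrange.nodal_monic, Lagrange.natDegree_nodal,
        Lagrange.natDegree_nodal, hcard', hm]
      ring
    have hnext : (N * N').coeff (2 * m + 2) = β := by
      have h2 : (N * N').nextCoeff = β := by
        rw [Lagrange.nodal_monic.nextCoeff_mul Lagrange.nodal_monic, Lagrange.nodal_eq,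
          Lagrange.nodal_eq, prod_X_sub_C_nextCoeff, prod_X_sub_C_nextCoeff]
        have := Finset.add_sum_erase S id hβ
        simp only [id] at this ⊢
        linarith
      rwa [nextCoeff_of_natDegree_pos (by omega), hnat] at h2
    -- Subtracting `d * N * N'` drops the degree by one and gives up only the derivative condition
    -- at `β`.
    have hp := hG.coeff_nonneg (p := H - C d * (N * N')) (m := 2 * m + 1) (S := S)
      (D := S.erase β) ?_ (Finset.erase_subset _ _) ?_ ?_ (by omega)
    · rw [coeff_sub, coeff_C_mul, show 2 * m + 1 + 1 = 2 * m + 2 by ring, hnext] at hp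
      rw [hm, show 2 * (m + 2) - 2 = 2 * m + 2 by omega]
      nlinarith
    · rw [natDegree_le_iff_coeff_eq_zero]
      intro j hj
      rw [coeff_sub, coeff_C_mul]
      rcases eq_or_lt_of_le (show 2 * m + 3 ≤ j by omega) with rfl | hj'
      · have : (N * N').coeff (2 * m + 3) = 1 := by rw [← hnat]; exact hmon.coeff_natDegree
        rw [this, hd]
        ring
      · rw [coeff_eq_zero_of_natDegree_lt (by omega), coeff_eq_zero_of_natDegree_lt (by omega)]
        ring
    · intro x hx
      refine ⟨hS x hx, ?_⟩
      simp [hN0 x hx, h0 x hx]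
    · intro x hx
      have hx' := Finset.mem_of_mem_erase hx
      have : N'.eval x = 0 := Lagrange.eval_nodal_at_node (v := id) hx
      simp [hN0 x hx', h1 x hx', this]
  · intro t ht
    by_cases htS : t ∈ S
    · exact (h0 t htS).le
    set N := Lagrange.nodal S id with hN
    have hNt : 0 < N.eval t ^ 2 := by
      have : N.eval t ≠ 0 := Lagrange.eval_nodal_not_at_node (v := id)
        (fun i hi h => htS (by rw [h]; exact hi))
      positivity
    -- `κ` is chosen so that `H + κ N²` also takes the value `G 0 t` at `t`. It is then the top
    -- divided difference, hence nonnegative, which is the inequality at `t`.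
    set κ := (G 0 t - H.eval t) / N.eval t ^ 2 with hκ
    have hmon : (N ^ 2).Monic := Lagrange.nodal_monic.pow 2
    have hnat : (N ^ 2).natDegree = 2 * S.card := by
      rw [natDegree_pow, Lagrange.natDegree_nodal]
    obtain ⟨m, hm⟩ : ∃ m, 2 * S.card = m + 1 := ⟨2 * S.card - 1, by omega⟩
    have hp := hG.coeff_nonneg (p := H + C κ * N ^ 2) (m := m) (S := insert t S) (D := S) ?_
      (Finset.subset_insert _ _) ?_ ?_ (by rw [Finset.card_insert_of_notMem htS]; omega)
    · have h2 : (N ^ 2).coeff (m + 1) = 1 := by rw [← hm, ← hnat]; exact hmon.coeff_natDegree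
      rw [coeff_add, coeff_C_mul, h2, coeff_eq_zero_of_natDegree_lt (by omega), zero_add,
        mul_one, hκ, le_div_iff₀ hNt] at hp
      linarith
    · refine natDegree_add_le_of_degree_le (by omega) ((natDegree_C_mul_le _ _).trans (by omega))
    · intro x hx
      rcases Finset.mem_insert.1 hx with rfl | hx
      · refine ⟨ht, ?_⟩
        simp only [eval_add, eval_mul, eval_C, eval_pow, hκ, div_mul_cancel₀ _ hNt.ne']
        ring
      · exact ⟨hS x hx, by simp [hN0 x hx, h0 x hx]⟩
    · intro x hx
      simp [derivative_pow, hN0 x hx, h1 x hx]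

/-! ### Absolutely monotone potentials -/

theorem IsAbsolutelyMonotonePotential.nonnegDerivatives {h : ℝ → ℝ≥0∞}
    (hh : IsAbsolutelyMonotonePotential h) :
    NonnegDerivatives (-1) 1
      (fun i => iteratedDerivWithin i (fun t => (h t).toReal) (Ico (-1 : ℝ) 1)) := by
  have hu : UniqueDiffOn ℝ (Ico (-1 : ℝ) 1) := uniqueDiffOn_Ico _ _
  refine ⟨fun i x hx => ?_, fun i x hx =>
    hh.absolutelyMonotoneOn.iteratedDerivWithin_nonneg hu i (Ioo_subset_Ico_self hx)⟩
  have hd := (hh.absolutelyMonotoneOn.contDiffOn.differentiableOn_iteratedDerivWithin (m := i)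
    (by exact_mod_cast WithTop.coe_lt_top _) hu) x (Ioo_subset_Ico_self hx)
  have hn : Ico (-1 : ℝ) 1 ∈ nhds x := Ico_mem_nhds hx.1 hx.2
  have := hd.hasDerivWithinAt.hasDerivAt hn
  rwa [← iteratedDerivWithin_succ] at this

/-- The inequality passes to -1 by continuity of h there. At 1, where h may be infinite or jump,
monotonicity bounds f(t) ≤ h(t) ≤ h(1) and only f is taken to the limit. -/
theorem IsAbsolutelyMonotonePotential.eval_le {h : ℝ → ℝ≥0∞}
    (hh : IsAbsolutelyMonotonePotential h) {f : ℝ[X]}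
    (hf : ∀ t ∈ Ioo (-1 : ℝ) 1, f.eval t ≤ (h t).toReal) :
    ∀ t ∈ Icc (-1 : ℝ) 1, ((f.eval t : ℝ) : EReal) ≤ ((h t : ℝ≥0∞) : EReal) := by
  have hcoe : ∀ t ∈ Ico (-1 : ℝ) 1, ((h t : ℝ≥0∞) : EReal) = (((h t).toReal : ℝ) : EReal) :=
    fun t ht => by rw [EReal.coe_ennreal_toReal (hh.finite t ht)]
  have hIco : ∀ t ∈ Ico (-1 : ℝ) 1, f.eval t ≤ (h t).toReal := by
    intro t ht
    rcases eq_or_lt_of_le ht.1 with rfl | h1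
    · have hc := (hh.absolutelyMonotoneOn.contDiffOn.continuousOn (-1) ht).mono
        (Ioo_subset_Ico_self (a := (-1 : ℝ)) (b := 1))
      have : (nhdsWithin (-1 : ℝ) (Ioo (-1) 1)).NeBot := by
        rw [← mem_closure_iff_nhdsWithin_neBot, closure_Ioo (by norm_num)]
        simp
      exact le_of_tendsto_of_tendsto (f.continuous.continuousWithinAt (s := Ioo (-1 : ℝ) 1)) hc
        (Filter.eventually_of_mem self_mem_nhdsWithin hf)
    · exact hf t ⟨h1, ht.2⟩
  intro t ht
  rcases lt_or_eq_of_le ht.2 with h1 | rfl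
  · rw [hcoe t ⟨ht.1, h1⟩]
    exact_mod_cast hIco t ⟨ht.1, h1⟩
  · have : (nhdsWithin (1 : ℝ) (Ioo (-1) 1)).NeBot := by
      rw [← mem_closure_iff_nhdsWithin_neBot, closure_Ioo (by norm_num)]
      simp
    have hc : Filter.Tendsto (fun t => ((f.eval t : ℝ) : EReal)) (nhdsWithin (1 : ℝ) (Ioo (-1) 1))
        (nhds ((f.eval 1 : ℝ) : EReal)) :=
      (continuous_coe_real_ereal.comp f.continuous).continuousWithinAt
    refine le_of_tendsto hc (Filter.eventually_of_mem self_mem_nhdsWithin fun t ht' => ?_)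
    have h2 := hh.monotoneOn (Ioo_subset_Icc_self ht') ht ht'.2.le
    calc ((f.eval t : ℝ) : EReal) ≤ ((h t : ℝ≥0∞) : EReal) := by
          rw [hcoe t (Ioo_subset_Ico_self ht')]
          exact_mod_cast hf t ht'
      _ ≤ _ := by exact_mod_cast h2

/-! ### The mean functional -/

/-- The mean of a polynomial with respect to `μ_n`, as a linear functional. -/
def mean {n : ℕ} (hn : 2 ≤ n) : ℝ[X] →ₗ[ℝ] ℝ :=
  (∫ s in Icc (-1 : ℝ) 1, weight n s)⁻¹ • weightIntegral hn

theorem integral_eval_eq_mean {n : ℕ} (hn : 2 ≤ n) (p : ℝ[X]) :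
    ∫ t, p.eval t ∂gegenbauerMeasure n = mean hn p := by
  rw [integral_gegenbauerMeasure hn]
  rfl

theorem mean_C_mul {n : ℕ} (hn : 2 ≤ n) (c : ℝ) (p : ℝ[X]) :
    mean hn (C c * p) = c * mean hn p := by
  rw [C_mul', map_smul, smul_eq_mul]

theorem mean_mul_self_pos {n : ℕ} (hn : 2 ≤ n) {p : ℝ[X]} (hp : p ≠ 0) : 0 < mean hn (p * p) := by
  have hW := integral_weight_pos hn
  refine mul_pos (inv_pos.2 hW) ?_
  change 0 < ∫ t in Icc (-1 : ℝ) 1, weight n t * (p * p).eval t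
  rw [setIntegral_pos_iff_support_of_nonneg_ae]
  · refine lt_of_lt_of_le ?_ (measure_mono (s := Ioo (-1 : ℝ) 1 \ p.roots.toFinset) ?_)
    · rw [measure_sdiff_null (p.roots.toFinset.finite_toSet.measure_zero _)]
      simp
    · intro t ht
      refine ⟨?_, ht.1.1.le, ht.1.2.le⟩
      have h1 : 0 < 1 - t ^ 2 := by nlinarith [ht.1.1, ht.1.2]
      have h2 : p.eval t ≠ 0 := fun h => ht.2 (by simpa [hp] using h)
      rw [Function.mem_support, eval_mul]
      exact mul_ne_zero (Real.rpow_pos_of_pos h1 _).ne' (mul_ne_zero h2 h2)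
  · refine (ae_restrict_iff' measurableSet_Icc).2 (Filter.Eventually.of_forall fun t ht => ?_)
    simp only [eval_mul]
    exact mul_nonneg (weight_nonneg ht) (mul_self_nonneg _)
  · exact integrable_weight_mul_eval hn _

theorem mean_gegenbauer_mul_of_ne {n : ℕ} (hn : 2 ≤ n) {i j : ℕ} (hij : i ≠ j) :
    mean hn (gegenbauer n i * gegenbauer n j) = 0 := by
  rw [← integral_eval_eq_mean]
  simpa only [eval_mul] using gegenbauer_orthogonal hn hij

/-! ### Leading coefficients, degrees, spans -/

theorem gegenbauer_ne_zero {n : ℕ} (hn : 2 ≤ n) (i : ℕ) : gegenbauer n i ≠ 0 := fun h => by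
  simpa [h] using gegenbauer_eval_one hn i

theorem mean_gegenbauer_sq_pos {n : ℕ} (hn : 2 ≤ n) (i : ℕ) :
    0 < mean hn (gegenbauer n i * gegenbauer n i) :=
  mean_mul_self_pos hn (gegenbauer_ne_zero hn i)

theorem degree_gegenbauer {n : ℕ} (hn : 2 ≤ n) (i : ℕ) : (gegenbauer n i).degree = i := by
  rw [degree_eq_natDegree (gegenbauer_ne_zero hn i), natDegree_gegenbauer hn]

/-- The Gegenbauer polynomials as a polynomial sequence. -/
def gegenbauerSequence {n : ℕ} (hn : 2 ≤ n) : Polynomial.Sequence ℝ where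
  elems' := gegenbauer n
  degree_eq' := degree_gegenbauer hn

theorem span_gegenbauer_image_Iio {n : ℕ} (hn : 2 ≤ n) (m : ℕ) :
    Submodule.span ℝ (gegenbauer n '' Iio m) = degreeLT ℝ m :=
  (gegenbauerSequence hn).span_degreeLT fun i _ =>
    (leadingCoeff_ne_zero.2 (gegenbauer_ne_zero hn i)).isUnit

theorem mean_gegenbauer_mul_of_degree_lt {n : ℕ} (hn : 2 ≤ n) {m : ℕ} {p : ℝ[X]}
    (hp : p.degree < m) : mean hn (gegenbauer n m * p) = 0 := by
  rw [← mem_degreeLT, ← span_gegenbauer_image_Iio hn] at hp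
  induction hp using Submodule.span_induction with
  | mem x hx =>
    obtain ⟨i, hi, rfl⟩ := hx
    exact mean_gegenbauer_mul_of_ne hn (ne_of_gt hi)
  | zero => simp
  | add x y _ _ hx hy => rw [mul_add, map_add, hx, hy, add_zero]
  | smul c x _ hx => rw [mul_smul_comm, map_smul, hx, smul_zero]

theorem coeff_gegenbauer_succ_succ {n : ℕ} (hn : 2 ≤ n) (i j : ℕ) :
    ((i : ℝ) + n - 1) * (gegenbauer n (i + 2)).coeff (j + 1) =
      (2 * (i : ℝ) + n) * (gegenbauer n (i + 1)).coeff j -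
        ((i : ℝ) + 1) * (gegenbauer n i).coeff (j + 1) := by
  have h := congrArg (fun p => p.coeff (j + 1)) (gegenbauer_rec hn i)
  have e1 : ((i : ℝ[X]) + (n : ℝ[X]) - 1) = C ((i : ℝ) + n - 1) := by simp
  have e2 : (2 * (i : ℝ[X]) + (n : ℝ[X])) = C (2 * (i : ℝ) + n) := by
    simp only [map_add, map_mul, map_natCast, map_ofNat]
  have e3 : ((i : ℝ[X]) + 1) = C ((i : ℝ) + 1) := by simp
  simp only [e1, e2, e3, mul_assoc, coeff_sub, coeff_C_mul, coeff_X_mul] at h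
  exact h

theorem coeff_gegenbauer_self_succ {n : ℕ} (hn : 2 ≤ n) (i : ℕ) :
    ((i : ℝ) + n - 1) * (gegenbauer n (i + 2)).coeff (i + 2) =
      (2 * (i : ℝ) + n) * (gegenbauer n (i + 1)).coeff (i + 1) := by
  rw [coeff_gegenbauer_succ_succ hn i (i + 1),
    coeff_eq_zero_of_natDegree_lt (p := gegenbauer n i) (by rw [natDegree_gegenbauer hn]; omega)]
  ring

theorem coeff_gegenbauer_self_pos {n : ℕ} (hn : 2 ≤ n) (i : ℕ) :
    0 < (gegenbauer n i).coeff i := by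
  have hn' : (2 : ℝ) ≤ n := by exact_mod_cast hn
  induction i using Nat.twoStepInduction with
  | zero => simp [gegenbauer]
  | one => simp [gegenbauer]
  | more i _ h1 =>
    have hi : (0 : ℝ) ≤ i := Nat.cast_nonneg i
    refine pos_of_mul_pos_right (a := (i : ℝ) + n - 1) ?_ (by linarith)
    rw [coeff_gegenbauer_self_succ hn]
    exact mul_pos (by linarith) h1

theorem gegenbauer_comp_neg_X (n i : ℕ) :
    (gegenbauer n i).comp (-X) = (-1) ^ i * gegenbauer n i := by
  induction i using Nat.twoStepInduction with
  | zero => simp [gegenbauer]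
  | one => simp [gegenbauer]
  | more i h0 h1 =>
    rw [gegenbauer]
    simp only [mul_comp, sub_comp, C_comp, X_comp, h0, h1]
    ring

theorem eval_neg_gegenbauer (n i : ℕ) (t : ℝ) :
    (gegenbauer n i).eval (-t) = (-1) ^ i * (gegenbauer n i).eval t := by
  have h := congrArg (eval t) (gegenbauer_comp_neg_X n i)
  simpa [eval_comp] using h

theorem coeff_gegenbauer_succ_self {n : ℕ} (hn : 2 ≤ n) (i : ℕ) :
    (gegenbauer n (i + 1)).coeff i = 0 := by
  have hn' : (2 : ℝ) ≤ n := by exact_mod_cast hn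
  induction i with
  | zero => simp [gegenbauer]
  | succ i ih =>
    have hi : (0 : ℝ) ≤ i := Nat.cast_nonneg i
    have h := coeff_gegenbauer_succ_succ hn i i
    rw [ih, coeff_eq_zero_of_natDegree_lt (p := gegenbauer n i)
      (by rw [natDegree_gegenbauer hn]; omega), mul_zero, mul_zero, sub_zero] at h
    exact (mul_eq_zero.1 h).resolve_left (by linarith)

/-- This ratio of the two top nonzero coefficients is all that is needed about lower-order terms; it
makes every P_{2k} component below computable from two coefficients. -/
theorem coeff_gegenbauer_sub_two {n : ℕ} (hn : 2 ≤ n) (m : ℕ) :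
    (gegenbauer n (m + 2)).coeff m =
      -((m + 2) * (m + 1) / (2 * (n + 2 * m)) * (gegenbauer n (m + 2)).coeff (m + 2)) := by
  have hn' : (2 : ℝ) ≤ n := by exact_mod_cast hn
  induction m with
  | zero =>
    have hn1 : (n : ℝ) - 1 ≠ 0 := by linarith
    have hn0 : (n : ℝ) ≠ 0 := by linarith
    simp only [gegenbauer, coeff_C_mul, coeff_sub, mul_assoc, coeff_X_mul_zero, coeff_X_mul]
    simp [coeff_X, coeff_one]
    field_simp
  | succ m ih =>
    have hm : (0 : ℝ) ≤ m := Nat.cast_nonneg m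
    have h1 := coeff_gegenbauer_succ_succ hn (m + 1) m
    have h2 := coeff_gegenbauer_self_succ hn (m + 1)
    have h3 := coeff_gegenbauer_self_succ hn m
    rw [show m + 1 + 1 = m + 2 by ring, ih] at h1
    push_cast at h1 h2 ⊢
    rw [show m + 1 + 1 = m + 2 by ring] at h2
    have hA : (m : ℝ) + 1 + n - 1 ≠ 0 := by linarith
    have hB : 2 * (m : ℝ) + n ≠ 0 := by linarith
    have hB' : (n : ℝ) + 2 * m ≠ 0 := by linarith
    have hC : (n : ℝ) + 2 * (m + 1) ≠ 0 := by linarith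
    have hD : 2 * ((m : ℝ) + 1) + n ≠ 0 := by linarith
    generalize (gegenbauer n (m + 1 + 2)).coeff (m + 1) = u at *
    generalize (gegenbauer n (m + 1 + 2)).coeff (m + 1 + 2) = v at *
    generalize (gegenbauer n (m + 2)).coeff (m + 2) = w at *
    generalize (gegenbauer n (m + 1)).coeff (m + 1) = z at *
    have hz : z = ((m : ℝ) + n - 1) * w / (2 * m + n) := by
      field_simp
      linarith
    have hw : w = ((m : ℝ) + 1 + n - 1) * v / (2 * (m + 1) + n) := by
      field_simp
      linarith
    apply mul_left_cancel₀ hA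
    rw [h1, hz, hw]
    field_simp
    ring

/-! ### Means of products with Gegenbauer polynomials -/

theorem mean_mul_gegenbauer_of_natDegree_le {n : ℕ} (hn : 2 ≤ n) {m : ℕ} {p : ℝ[X]}
    (hp : p.natDegree ≤ m) :
    mean hn (gegenbauer n m * p) * (gegenbauer n m).coeff m =
      p.coeff m * mean hn (gegenbauer n m * gegenbauer n m) := by
  have hl := coeff_gegenbauer_self_pos hn m
  set l := (gegenbauer n m).coeff m with hldef
  have hd : (p - C (p.coeff m / l) * gegenbauer n m).degree < m := by
    rw [degree_lt_iff_coeff_zero]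
    intro j hj
    rw [coeff_sub, coeff_C_mul]
    rcases eq_or_lt_of_le hj with rfl | hj
    · rw [← hldef, div_mul_cancel₀ _ hl.ne', sub_self]
    · rw [coeff_eq_zero_of_natDegree_lt (p := p) (by omega), coeff_eq_zero_of_natDegree_lt
        (p := gegenbauer n m) (by rw [natDegree_gegenbauer hn]; omega)]
      ring
  have h := mean_gegenbauer_mul_of_degree_lt hn hd
  rw [mul_sub, map_sub, mul_left_comm, mean_C_mul, sub_eq_zero] at h
  rw [h]
  field_simp

/-- Subtracting multiples of P_{m+2} and P_{m+1} leaves the mean against P_m unchanged and reduces p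
to degree m. The multiple of P_{m+1} does not touch the coefficient of degree m, by parity. -/
theorem mean_mul_gegenbauer_of_natDegree_le_add_two {n : ℕ} (hn : 2 ≤ n) {m : ℕ} {p : ℝ[X]}
    (hp : p.natDegree ≤ m + 2) :
    mean hn (gegenbauer n m * p) * (gegenbauer n m).coeff m =
      (p.coeff m + (m + 2) * (m + 1) / (2 * (n + 2 * m)) * p.coeff (m + 2)) *
        mean hn (gegenbauer n m * gegenbauer n m) := by
  have hl1 := (coeff_gegenbauer_self_pos hn (m + 1)).ne'
  have hl2 := (coeff_gegenbauer_self_pos hn (m + 2)).ne'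
  set c := p.coeff (m + 2) / (gegenbauer n (m + 2)).coeff (m + 2) with hc
  set d := p.coeff (m + 1) / (gegenbauer n (m + 1)).coeff (m + 1) with hd
  set r := p - C c * gegenbauer n (m + 2) - C d * gegenbauer n (m + 1) with hr
  have hrd : r.natDegree ≤ m := by
    rw [natDegree_le_iff_coeff_eq_zero]
    intro j hj
    rw [hr, coeff_sub, coeff_sub, coeff_C_mul, coeff_C_mul]
    rcases (show j = m + 1 ∨ j = m + 2 ∨ m + 2 < j by omega) with rfl | rfl | hj
    · rw [coeff_gegenbauer_succ_self hn (m + 1), hd, div_mul_cancel₀ _ hl1]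
      ring
    · rw [hc, div_mul_cancel₀ _ hl2, coeff_eq_zero_of_natDegree_lt (p := gegenbauer n (m + 1))
        (by rw [natDegree_gegenbauer hn]; omega)]
      ring
    · rw [coeff_eq_zero_of_natDegree_lt (by omega), coeff_eq_zero_of_natDegree_lt
        (by rw [natDegree_gegenbauer hn]; omega), coeff_eq_zero_of_natDegree_lt
        (by rw [natDegree_gegenbauer hn]; omega)]
      ring
  have h := mean_mul_gegenbauer_of_natDegree_le hn hrd
  have h1 : mean hn (gegenbauer n m * r) = mean hn (gegenbauer n m * p) := by
    rw [hr, mul_sub, mul_sub, map_sub, map_sub, mul_left_comm, mean_C_mul,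
      mul_left_comm (gegenbauer n m) (C d), mean_C_mul, mean_gegenbauer_mul_of_ne hn (by omega),
      mean_gegenbauer_mul_of_ne hn (by omega)]
    ring
  have h2 : r.coeff m = p.coeff m + (m + 2) * (m + 1) / (2 * (n + 2 * m)) * p.coeff (m + 2) := by
    rw [hr, coeff_sub, coeff_sub, coeff_C_mul, coeff_C_mul, coeff_gegenbauer_succ_self hn,
      coeff_gegenbauer_sub_two hn, hc]
    field_simp
    ring
  rw [← h1, h, h2]

theorem mean_gegenbauer_sq_rec {n : ℕ} (hn : 2 ≤ n) (i : ℕ) :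
    (2 * (i : ℝ) + n) * (gegenbauer n i).coeff i *
        mean hn (gegenbauer n (i + 1) * gegenbauer n (i + 1)) =
      ((i : ℝ) + 1) * (gegenbauer n (i + 1)).coeff (i + 1) *
        mean hn (gegenbauer n i * gegenbauer n i) := by
  -- The mean of t P_i P_{i+1} is evaluated twice: from leading coefficients here, and from the
  -- recurrence in `h2`.
  have h1 := mean_mul_gegenbauer_of_natDegree_le hn (m := i + 1) (p := X * gegenbauer n i)
    (by rw [natDegree_X_mul (gegenbauer_ne_zero hn i), natDegree_gegenbauer hn])
  rw [coeff_X_mul] at h1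
  have h2 : ((i : ℝ) + n - 1) * mean hn (gegenbauer n (i + 2) * gegenbauer n i) =
      (2 * (i : ℝ) + n) * mean hn (gegenbauer n (i + 1) * (X * gegenbauer n i))
      - ((i : ℝ) + 1) * mean hn (gegenbauer n i * gegenbauer n i) := by
    simp only [← mean_C_mul, ← map_sub]
    congr 1
    have := gegenbauer_rec hn i
    simp only [map_add, map_sub, map_natCast, map_mul, map_ofNat, C_1]
    linear_combination gegenbauer n i * this
  rw [mean_gegenbauer_mul_of_ne hn (by omega), mul_zero] at h2
  linear_combination (-(2 * (i : ℝ) + n)) * h1 - (gegenbauer n (i + 1)).coeff (i + 1) * h2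

theorem coeff_mul_add_add_two {f g : ℝ[X]} {a b : ℕ} (hf : f.natDegree ≤ a + 2)
    (hg : g.natDegree ≤ b + 2) :
    (f * g).coeff (a + b + 2) =
      f.coeff (a + 2) * g.coeff b + f.coeff (a + 1) * g.coeff (b + 1) +
        f.coeff a * g.coeff (b + 2) := by
  -- Reversing the polynomials turns the coefficient two below the top into the coefficient of
  -- degree two, a sum of three terms.
  have h := congrArg (fun p => p.coeff 2) (reflect_mul f g hf hg)
  simp only [coeff_mul, Finset.Nat.antidiagonal_succ, Finset.Nat.antidiagonal_zero,
    coeff_reflect] at h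
  rw [revAt_le (by omega)] at h
  simp [revAt_le] at h
  rw [show a + b + 2 = a + 2 + (b + 2) - 2 by omega, coeff_mul, h]
  ring

/-! ### The space spanned by the Gegenbauer polynomials with index in `T^k` -/

theorem skipOneAddTwo_union_zero {k : ℕ} (hk : 1 ≤ k) :
    skipOneAddTwo k ∪ {0} = Iio (2 * k) ∪ {2 * k + 1, 2 * k + 2} := by
  ext i
  simp only [skipOneAddTwo, mem_union, mem_sdiff, mem_Icc, mem_singleton_iff, mem_Iio,
    mem_insert_iff]
  omega

theorem gegenbauerSpace_skipOneAddTwo {n k : ℕ} (hn : 2 ≤ n) (hk : 1 ≤ k) :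
    degreeLT ℝ (2 * k) ⊔ Submodule.span ℝ {gegenbauer n (2 * k + 1), gegenbauer n (2 * k + 2)} =
      gegenbauerSpace n (skipOneAddTwo k) := by
  rw [gegenbauerSpace, skipOneAddTwo_union_zero hk, image_union, Submodule.span_union,
    span_gegenbauer_image_Iio hn, image_pair]

theorem disjoint_degreeLT_span_gegenbauer {n : ℕ} (hn : 2 ≤ n) (m : ℕ) :
    Disjoint (degreeLT ℝ m) (Submodule.span ℝ {gegenbauer n (m + 1), gegenbauer n (m + 2)}) := by
  rw [Submodule.disjoint_def]
  intro p hp hp'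
  obtain ⟨x, y, rfl⟩ := Submodule.mem_span_pair.1 hp'
  rw [mem_degreeLT, degree_lt_iff_coeff_zero] at hp
  have hy : y = 0 := by
    have := hp (m + 2) (by omega)
    rw [coeff_add, coeff_smul, coeff_smul, coeff_eq_zero_of_natDegree_lt
      (by rw [natDegree_gegenbauer hn]; omega), smul_zero, zero_add, smul_eq_mul] at this
    exact (mul_eq_zero.1 this).resolve_right (coeff_gegenbauer_self_pos hn _).ne'
  have hx : x = 0 := by
    have := hp (m + 1) (by omega)
    rw [hy, zero_smul, add_zero, coeff_smul, smul_eq_mul] at this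
    exact (mul_eq_zero.1 this).resolve_right (coeff_gegenbauer_self_pos hn _).ne'
  simp [hx, hy]

/-- In degree at most 2k+2 the space is exactly the orthogonal complement of P_{2k}. After removing
the components along P_{2k+1} and P_{2k+2}, orthogonality kills the coefficient of degree 2k. -/
theorem mem_gegenbauerSpace_of_mean_eq_zero {n k : ℕ} (hn : 2 ≤ n) (hk : 1 ≤ k) {p : ℝ[X]}
    (hp : p.natDegree ≤ 2 * k + 2) (hmean : mean hn (gegenbauer n (2 * k) * p) = 0) :
    p ∈ gegenbauerSpace n (skipOneAddTwo k) := by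
  have hl0 := (coeff_gegenbauer_self_pos hn (2 * k)).ne'
  have hl1 := (coeff_gegenbauer_self_pos hn (2 * k + 1)).ne'
  have hl2 := (coeff_gegenbauer_self_pos hn (2 * k + 2)).ne'
  set c := p.coeff (2 * k + 2) / (gegenbauer n (2 * k + 2)).coeff (2 * k + 2) with hc
  set d := p.coeff (2 * k + 1) / (gegenbauer n (2 * k + 1)).coeff (2 * k + 1) with hd
  set r := p - (d • gegenbauer n (2 * k + 1) + c • gegenbauer n (2 * k + 2)) with hr
  have hrd : r.natDegree ≤ 2 * k := by
    rw [natDegree_le_iff_coeff_eq_zero]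
    intro j hj
    rw [hr, coeff_sub, coeff_add, coeff_smul, coeff_smul, smul_eq_mul, smul_eq_mul]
    rcases (show j = 2 * k + 1 ∨ j = 2 * k + 2 ∨ 2 * k + 2 < j by omega) with rfl | rfl | hj
    · rw [coeff_gegenbauer_succ_self hn (2 * k + 1), hd, div_mul_cancel₀ _ hl1]
      ring
    · rw [hc, div_mul_cancel₀ _ hl2, coeff_eq_zero_of_natDegree_lt
        (p := gegenbauer n (2 * k + 1)) (by rw [natDegree_gegenbauer hn]; omega)]
      ring
    · rw [coeff_eq_zero_of_natDegree_lt (by omega), coeff_eq_zero_of_natDegree_lt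
        (by rw [natDegree_gegenbauer hn]; omega), coeff_eq_zero_of_natDegree_lt
        (by rw [natDegree_gegenbauer hn]; omega)]
      ring
  have h1 : mean hn (gegenbauer n (2 * k) * r) = 0 := by
    rw [hr, mul_sub, map_sub, hmean, mul_add, map_add, mul_smul_comm, mul_smul_comm, map_smul,
      map_smul, mean_gegenbauer_mul_of_ne hn (by omega), mean_gegenbauer_mul_of_ne hn (by omega)]
    simp
  have h2 := mean_mul_gegenbauer_of_natDegree_le hn hrd
  rw [h1, zero_mul, eq_comm, mul_eq_zero] at h2
  have h3 := h2.resolve_right (mean_gegenbauer_sq_pos hn _).ne'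
  rw [← gegenbauerSpace_skipOneAddTwo hn hk, ← sub_add_cancel p
    (d • gegenbauer n (2 * k + 1) + c • gegenbauer n (2 * k + 2)), ← hr]
  refine Submodule.add_mem_sup ?_ (Submodule.mem_span_pair.2 ⟨d, c, rfl⟩)
  rw [mem_degreeLT, degree_lt_iff_coeff_zero]
  intro j hj
  rcases eq_or_lt_of_le hj with rfl | hj
  · exact h3
  · exact coeff_eq_zero_of_natDegree_lt (by omega)

/-! ### Interlacing of zeros -/

/-- The points `x 1 < … < x k` lie strictly between `x 0 = -1` and `x (k + 1) = 1` and are the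
zeros of the polynomial `p` of degree at most `k`. -/
structure IsRootChain (k : ℕ) (x : ℕ → ℝ) (p : ℝ[X]) : Prop where
  zero : x 0 = -1
  last : x (k + 1) = 1
  lt_succ : ∀ i ≤ k, x i < x (i + 1)
  eq_prod : p = C (p.coeff k) * ∏ i ∈ Finset.range k, (X - C (x (i + 1)))

theorem lt_of_lt_of_forall_lt_succ {k : ℕ} {x : ℕ → ℝ} (hx : ∀ i ≤ k, x i < x (i + 1)) {i j : ℕ}
    (hij : i < j) (hj : j ≤ k + 1) : x i < x j := by
  induction j, hij using Nat.le_induction with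
  | base => exact hx i (by omega)
  | succ j hij ih => exact (ih (by omega)).trans (hx j (by omega))

theorem le_of_le_of_forall_lt_succ {k : ℕ} {x : ℕ → ℝ} (hx : ∀ i ≤ k, x i < x (i + 1)) {i j : ℕ}
    (hij : i ≤ j) (hj : j ≤ k + 1) : x i ≤ x j := by
  rcases eq_or_lt_of_le hij with rfl | h
  · exact le_rfl
  · exact (lt_of_lt_of_forall_lt_succ hx h hj).le

theorem eq_C_mul_prod_of_eval_eq_zero {m : ℕ} {v : ℕ → ℝ} {q : ℝ[X]} (hq : q.natDegree ≤ m)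
    (hv : Set.InjOn v (Finset.range m)) (h0 : ∀ i < m, q.eval (v i) = 0) :
    q = C (q.coeff m) * ∏ i ∈ Finset.range m, (X - C (v i)) := by
  rw [← Lagrange.nodal_eq, ← sub_eq_zero]
  refine Polynomial.eq_zero_of_degree_lt_of_eval_index_eq_zero (Finset.range m) hv ?_ ?_
  · rw [degree_lt_iff_coeff_zero, Finset.card_range]
    intro j hj
    have hN : (Lagrange.nodal (Finset.range m) v).natDegree = m := by
      rw [Lagrange.natDegree_nodal, Finset.card_range]
    rw [coeff_sub, coeff_C_mul]
    rcases eq_or_lt_of_le hj with rfl | hj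
    · have : (Lagrange.nodal (Finset.range m) v).coeff m = 1 := by
        have h := Lagrange.nodal_monic (s := Finset.range m) (v := v)
        rwa [Monic, leadingCoeff, hN] at h
      rw [this]
      ring
    · rw [coeff_eq_zero_of_natDegree_lt (p := q) (by omega),
        coeff_eq_zero_of_natDegree_lt (p := Lagrange.nodal _ _) (by omega)]
      ring
  · intro i hi
    rw [eval_sub, eval_mul, Lagrange.eval_nodal_at_node hi, h0 i (Finset.mem_range.1 hi)]
    ring

/-- The endpoints ±1 count among the k+2 points of alternating sign, so the intermediate value
theorem yields k+1 zeros, which exhausts the degree. -/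
theorem exists_isRootChain_of_sign_changes {k : ℕ} {x : ℕ → ℝ} (hx0 : x 0 = -1)
    (hx1 : x (k + 1) = 1) (hx : ∀ i ≤ k, x i < x (i + 1)) {q : ℝ[X]} (hq : q.natDegree ≤ k + 1)
    (hs : ∀ i ≤ k + 1, 0 < (-1) ^ (k + 1 + i) * q.eval (x i)) :
    ∃ y : ℕ → ℝ, IsRootChain (k + 1) y q ∧ ∀ i ≤ k, x i < y (i + 1) ∧ y (i + 1) < x (i + 1) := by
  have hz : ∀ i, ∃ z, i ≤ k → z ∈ Ioo (x i) (x (i + 1)) ∧ q.eval z = 0 := by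
    intro i
    by_cases hi : i ≤ k
    · have h1 := hs i (by omega)
      have h2 := hs (i + 1) (by omega)
      rw [← add_assoc, pow_succ] at h2
      have hc := (C ((-1 : ℝ) ^ (k + 1 + i)) * q).continuous.continuousOn
        (s := Icc (x i) (x (i + 1)))
      obtain ⟨z, hz, hz0⟩ := intermediate_value_Ioo' (hx i hi).le hc
        (show (0 : ℝ) ∈ Ioo _ _ from ⟨by rw [eval_mul, eval_C]; linarith,
          by rw [eval_mul, eval_C]; exact h1⟩)
      refine ⟨z, fun _ => ⟨hz, ?_⟩⟩
      simp only [eval_mul, eval_C] at hz0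
      exact (mul_eq_zero.1 hz0).resolve_left (pow_ne_zero _ (by norm_num))
    · exact ⟨0, fun h => absurd h hi⟩
  choose z hz using hz
  set y : ℕ → ℝ := fun j => if j = 0 then -1 else if j = k + 2 then 1 else z (j - 1) with hy
  have hyz : ∀ i ≤ k, y (i + 1) = z i := fun i hi => by
    simp only [hy, if_neg (show i + 1 ≠ 0 by omega), if_neg (show i + 1 ≠ k + 2 by omega),
      Nat.add_sub_cancel]
  have hy0 : y 0 = -1 := by simp [hy]
  have hyl : y (k + 2) = 1 := by simp [hy]
  have hlt : ∀ i ≤ k + 1, y i < y (i + 1) := by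
    intro i hi
    rcases Nat.eq_zero_or_pos i with rfl | hi0
    · rw [hyz 0 (by omega), hy0, ← hx0]
      exact (hz 0 (by omega)).1.1
    · obtain ⟨j, rfl⟩ : ∃ j, i = j + 1 := ⟨i - 1, by omega⟩
      rw [hyz j (by omega)]
      have h1 := (hz j (by omega)).1.2
      rcases eq_or_lt_of_le hi with h | h
      · obtain rfl : j = k := by omega
        rw [hyl, ← hx1]
        exact h1
      · rw [hyz (j + 1) (by omega)]
        exact h1.trans (hz (j + 1) (by omega)).1.1
  refine ⟨y, ⟨hy0, hyl, hlt, ?_⟩, fun i hi => by rw [hyz i hi]; exact (hz i hi).1⟩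
  refine eq_C_mul_prod_of_eval_eq_zero hq ?_ fun i hi => ?_
  · intro i hi j hj hij
    have hi := Finset.mem_range.1 hi
    have hj := Finset.mem_range.1 hj
    by_contra hne
    rcases Nat.lt_or_gt_of_ne hne with h | h
    · exact (lt_of_lt_of_forall_lt_succ hlt (show i + 1 < j + 1 by omega) (by omega)).ne hij
    · exact (lt_of_lt_of_forall_lt_succ hlt (show j + 1 < i + 1 by omega) (by omega)).ne' hij
  · rw [hyz i (by omega)]
    exact (hz i (by omega)).2

theorem IsRootChain.sign {k : ℕ} {x : ℕ → ℝ} {p : ℝ[X]} (h : IsRootChain k x p)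
    (hp : 0 < p.coeff k) {i : ℕ} (hi : i ≤ k) {t : ℝ} (h1 : x i < t) (h2 : t < x (i + 1)) :
    0 < (-1) ^ (k + i) * p.eval t := by
  have key : ∀ m, i ≤ m → m ≤ k →
      0 < (-1) ^ (m + i) * ∏ j ∈ Finset.range m, (t - x (j + 1)) := by
    intro m him
    induction m, him using Nat.le_induction with
    | base =>
      intro _
      rw [Even.neg_one_pow ⟨i, rfl⟩, one_mul]
      refine Finset.prod_pos fun j hj => sub_pos.2 (lt_of_le_of_lt ?_ h1)
      exact le_of_le_of_forall_lt_succ h.lt_succ (Finset.mem_range.1 hj) (by omega)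
    | succ m him ih =>
      intro hm
      have h3 : t < x (m + 1) :=
        h2.trans_le (le_of_le_of_forall_lt_succ h.lt_succ (by omega) (by omega))
      rw [Finset.prod_range_succ, show m + 1 + i = m + i + 1 by ring, pow_succ]
      nlinarith [ih (by omega)]
  rw [h.eq_prod, eval_mul, eval_C, eval_prod, mul_left_comm]
  refine mul_pos hp ?_
  simpa using key k hi le_rfl

theorem IsRootChain.eval_pos {k : ℕ} {x : ℕ → ℝ} {p : ℝ[X]} (h : IsRootChain k x p)
    (hp : 0 < p.coeff k) {t : ℝ} (ht : x k < t) : 0 < p.eval t := by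
  rw [h.eq_prod, eval_mul, eval_C, eval_prod]
  refine mul_pos hp (Finset.prod_pos fun j hj => ?_)
  rw [eval_sub, eval_X, eval_C, sub_pos]
  have hj := Finset.mem_range.1 hj
  exact lt_of_le_of_lt (le_of_le_of_forall_lt_succ h.lt_succ (by omega) (by omega)) ht

/-- The polynomial `P_{k+2} + b P_k`. -/
def quasiGegenbauer (n k : ℕ) (b : ℝ) : ℝ[X] := gegenbauer n (k + 2) + C b * gegenbauer n k

theorem natDegree_quasiGegenbauer_le {n : ℕ} (hn : 2 ≤ n) (k : ℕ) (b : ℝ) :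
    (quasiGegenbauer n k b).natDegree ≤ k + 2 :=
  natDegree_add_le_of_degree_le (natDegree_gegenbauer hn _).le
    ((natDegree_C_mul_le _ _).trans (by rw [natDegree_gegenbauer hn]; omega))

theorem coeff_quasiGegenbauer {n : ℕ} (hn : 2 ≤ n) (k : ℕ) (b : ℝ) :
    (quasiGegenbauer n k b).coeff (k + 2) = (gegenbauer n (k + 2)).coeff (k + 2) := by
  rw [quasiGegenbauer, coeff_add, coeff_C_mul, coeff_eq_zero_of_natDegree_lt
    (p := gegenbauer n k) (by rw [natDegree_gegenbauer hn]; omega), mul_zero, add_zero]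

theorem exists_isRootChain_quasiGegenbauer {n : ℕ} (hn : 2 ≤ n) {k : ℕ} {b : ℝ} (hb0 : 0 ≤ b)
    (hb : b * ((k : ℝ) + n - 1) < k + 1) {x : ℕ → ℝ}
    (hx : IsRootChain (k + 1) x (gegenbauer n (k + 1)))
    (hs : ∀ i < k + 1, 0 < (-1) ^ (k + i) * (gegenbauer n k).eval (x (i + 1))) :
    ∃ y : ℕ → ℝ, IsRootChain (k + 2) y (quasiGegenbauer n k b) ∧
      ∀ i ≤ k + 1, x i < y (i + 1) ∧ y (i + 1) < x (i + 1) := by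
  have hn' : (2 : ℝ) ≤ n := by exact_mod_cast hn
  have hk : (0 : ℝ) ≤ k := Nat.cast_nonneg k
  refine exists_isRootChain_of_sign_changes hx.zero hx.last hx.lt_succ
    (natDegree_quasiGegenbauer_le hn k b) fun i hi => ?_
  have hq : ∀ t, (quasiGegenbauer n k b).eval t =
      (gegenbauer n (k + 2)).eval t + b * (gegenbauer n k).eval t := by
    simp [quasiGegenbauer]
  rw [hq]
  rcases Nat.eq_zero_or_pos i with rfl | hi0
  · rw [hx.zero, eval_neg_gegenbauer, eval_neg_gegenbauer, gegenbauer_eval_one hn,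
      gegenbauer_eval_one hn]
    have h1 : ((-1 : ℝ) ^ k) * (-1) ^ k = 1 := by rw [← mul_pow]; norm_num
    have h2 : (-1 : ℝ) ^ (k + 1 + 1 + 0) * ((-1) ^ (k + 2) * 1 + b * ((-1) ^ k * 1)) =
        ((-1 : ℝ) ^ k) * (-1) ^ k * (1 + b) := by ring
    rw [h2, h1]
    linarith
  · obtain ⟨j, rfl⟩ : ∃ j, i = j + 1 := ⟨i - 1, by omega⟩
    rcases eq_or_lt_of_le hi with h | h
    · obtain rfl : j = k + 1 := by omega
      rw [show k + 1 + 1 = k + 2 from rfl, hx.last, gegenbauer_eval_one hn,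
        gegenbauer_eval_one hn, Even.neg_one_pow ⟨k + 2, by ring⟩]
      linarith
    · have hroot : (gegenbauer n (k + 1)).eval (x (j + 1)) = 0 := by
        rw [hx.eq_prod, eval_mul, eval_prod,
          Finset.prod_eq_zero (i := j) (Finset.mem_range.2 (by omega)) (by simp), mul_zero]
      -- At a zero of P_{k+1} the recurrence reads (k+n-1) P_{k+2} = -(k+1) P_k, so q = (b -
      -- (k+1)/(k+n-1)) P_k there; the bound on b fixes the sign.
      have hrec := congrArg (eval (x (j + 1))) (gegenbauer_rec hn k)
      simp only [eval_mul, eval_add, eval_sub, eval_natCast, eval_one, eval_X, eval_ofNat,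
        hroot] at hrec
      have h1 := hs j (by omega)
      set u := (gegenbauer n k).eval (x (j + 1))
      set v := (gegenbauer n (k + 2)).eval (x (j + 1))
      have hA : 0 < (k : ℝ) + n - 1 := by linarith
      have h2 : (-1 : ℝ) ^ (k + 1 + 1 + (j + 1)) * (v + b * u) = -((-1) ^ (k + j) * (v + b * u)) := by
        ring
      rw [h2]
      refine pos_of_mul_pos_right (a := (k : ℝ) + n - 1) ?_ hA.le
      have h3 : ((k : ℝ) + n - 1) * -((-1) ^ (k + j) * (v + b * u)) =
          (k + 1 - b * ((k : ℝ) + n - 1)) * ((-1) ^ (k + j) * u) := by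
        linear_combination (-(-1 : ℝ) ^ (k + j)) * hrec
      rw [h3]
      exact mul_pos (by linarith) h1

theorem exists_isRootChain_gegenbauer {n : ℕ} (hn : 2 ≤ n) (k : ℕ) :
    ∃ x : ℕ → ℝ, IsRootChain (k + 1) x (gegenbauer n (k + 1)) ∧
      (∀ i < k + 1, 0 < (-1) ^ (k + i) * (gegenbauer n k).eval (x (i + 1))) ∧
      ∀ j ≤ k + 1, ∀ t, x (k + 1) < t → 0 < (gegenbauer n j).eval t := by
  induction k with
  | zero =>
    refine ⟨fun j => (j : ℝ) - 1, ⟨by simp, by norm_num, fun i _ => by simp, ?_⟩, ?_, ?_⟩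
    · simp [gegenbauer]
    · intro i hi
      obtain rfl : i = 0 := by omega
      simp [gegenbauer]
    · intro j hj t ht
      rcases (show j = 0 ∨ j = 1 by omega) with rfl | rfl
      · simp [gegenbauer]
      · simpa [gegenbauer] using ht
  | succ k ih =>
    obtain ⟨x, hx, hs, hpos⟩ := ih
    -- With b = 0 the quasi-Gegenbauer polynomial is P_{k+2} itself, so interlacing propagates by
    -- induction.
    obtain ⟨y, hy, hxy⟩ := exists_isRootChain_quasiGegenbauer hn le_rfl
      (by rw [zero_mul]; positivity) hx hs
    rw [quasiGegenbauer, C_0, zero_mul, add_zero] at hy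
    refine ⟨y, hy, fun i hi => ?_, fun j hj t ht => ?_⟩
    · exact hx.sign (coeff_gegenbauer_self_pos hn _) (by omega) (hxy i (by omega)).1
        (hxy i (by omega)).2
    · rcases eq_or_lt_of_le hj with rfl | hj
      · exact hy.eval_pos (coeff_gegenbauer_self_pos hn _) ht
      · exact hpos j (by omega) t ((hxy (k + 1) le_rfl).1.trans ht)

/-- The product condition is interlacing in the form used for the weights: once β_i is removed, the
other nodes match the zeros of P_{k+1} in order, and β_i lies on the same side of both members of
each pair. -/
theorem exists_nodes_quasiGegenbauer {n : ℕ} (hn : 2 ≤ n) (k : ℕ) {b : ℝ} (hb0 : 0 ≤ b)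
    (hb : b * ((k : ℝ) + n - 1) < k + 1) :
    ∃ (x : Fin (k + 1) → ℝ) (β : Fin (k + 2) → ℝ), StrictMono β ∧ (∀ i, β i ∈ Ioo (-1 : ℝ) 1) ∧
      gegenbauer n (k + 1) = C ((gegenbauer n (k + 1)).coeff (k + 1)) * ∏ j, (X - C (x j)) ∧
      quasiGegenbauer n k b = C ((gegenbauer n (k + 2)).coeff (k + 2)) * ∏ i, (X - C (β i)) ∧
      (∀ i j, 0 < (β i - β (i.succAbove j)) * (β i - x j)) ∧
      ∀ j ≤ k + 1, 0 < (gegenbauer n j).eval (β (Fin.last (k + 1))) := by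
  obtain ⟨x, hx, hs, hpos⟩ := exists_isRootChain_gegenbauer hn k
  obtain ⟨y, hy, hxy⟩ := exists_isRootChain_quasiGegenbauer hn hb0 hb hx hs
  have hlt : ∀ {i j : ℕ}, i < j → j ≤ k + 3 → y i < y j :=
    fun hij hj => lt_of_lt_of_forall_lt_succ hy.lt_succ hij hj
  refine ⟨fun j => x (j + 1), fun i => y (i + 1), ?_, ?_, ?_, ?_, ?_, ?_⟩
  · intro i j hij
    exact hlt (Nat.succ_lt_succ hij) (by omega)
  · intro i
    rw [← hy.zero, ← hy.last]
    exact ⟨hlt (by omega) (by omega), hlt (by omega) (by omega)⟩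
  · rw [Fin.prod_univ_eq_prod_range (fun j => X - C (x (j + 1)))]
    exact hx.eq_prod
  · rw [Fin.prod_univ_eq_prod_range (fun j => X - C (y (j + 1))), ← coeff_quasiGegenbauer hn k b]
    exact hy.eq_prod
  · intro i j
    have hi := hxy i (by omega)
    rcases Nat.lt_or_ge j i with h | h
    · rw [Fin.succAbove_of_castSucc_lt _ _ (by rw [Fin.lt_def]; exact h)]
      have h1 : x (j + 1) ≤ x i := le_of_le_of_forall_lt_succ hx.lt_succ (by omega) (by omega)
      exact mul_pos (sub_pos.2 (hlt (by simpa using h) (by simp))) (by linarith [hi.1])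
    · rw [Fin.succAbove_of_le_castSucc _ _ (by rw [Fin.le_def]; exact h)]
      have h1 : x (i + 1) ≤ x (j + 1) := le_of_le_of_forall_lt_succ hx.lt_succ (by omega) (by omega)
      exact mul_pos_of_neg_of_neg
        (sub_neg.2 (hlt (by simp; omega) (by simp))) (by linarith [hi.2])
  · intro j hj
    exact hpos j hj _ (hxy (k + 1) le_rfl).1

/-! ### Quadrature at the zeros of `P_{k+2} + b P_k` -/

theorem mean_quasiGegenbauer_mul_eq_zero {n : ℕ} (hn : 2 ≤ n) {k : ℕ} {b : ℝ} {g : ℝ[X]}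
    (hg : g.degree < k) : mean hn (quasiGegenbauer n k b * g) = 0 := by
  rw [quasiGegenbauer, add_mul, map_add, mul_assoc, mean_C_mul,
    mean_gegenbauer_mul_of_degree_lt hn hg, mean_gegenbauer_mul_of_degree_lt hn
      (hg.trans (by exact_mod_cast (by omega : k < k + 2)))]
  ring

theorem exists_interpolatory_weights {n : ℕ} (hn : 2 ≤ n) {m : ℕ} {β : Fin m → ℝ}
    (hβ : Function.Injective β) :
    ∃ γ : Fin m → ℝ, ∀ f : ℝ[X], f.degree < m → mean hn f = ∑ i, γ i * f.eval (β i) := by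
  refine ⟨fun i => mean hn (Lagrange.basis Finset.univ β i), fun f hf => ?_⟩
  have h := Lagrange.eq_interpolate (s := Finset.univ) (v := β) (f := f) hβ.injOn (by simpa using hf)
  conv_lhs => rw [h, Lagrange.interpolate_apply, map_sum]
  exact Finset.sum_congr rfl fun i _ => by rw [mean_C_mul, mul_comm]

theorem exists_X_sub_C_mul_eq_sub (p : ℝ[X]) (t : ℝ) {m : ℕ} (hp : p.natDegree ≤ m + 1) :
    ∃ g : ℝ[X], p = (X - C t) * g + C (p.eval t) ∧ g.natDegree ≤ m ∧
      g.coeff m = p.coeff (m + 1) := by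
  refine ⟨p /ₘ (X - C t), ?_, ?_, ?_⟩
  · rw [add_comm, ← modByMonic_X_sub_C_eq_C_eval, modByMonic_add_div]
  · rw [natDegree_divByMonic _ (monic_X_sub_C t), natDegree_X_sub_C]
    omega
  · have h : p = (X - C t) * (p /ₘ (X - C t)) + C (p.eval t) := by
      rw [add_comm, ← modByMonic_X_sub_C_eq_C_eval, modByMonic_add_div]
    have hd : (p /ₘ (X - C t)).natDegree ≤ m := by
      rw [natDegree_divByMonic _ (monic_X_sub_C t), natDegree_X_sub_C]
      omega
    conv_rhs => rw [h]
    rw [coeff_add, coeff_C_succ, sub_mul, coeff_sub, coeff_X_mul, coeff_C_mul,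
      coeff_eq_zero_of_natDegree_lt (n := m + 1) (by omega)]
    ring

/-- Divide P_{k+1} by X - t with quotient g. Then P_{k+1} w = q g + P_{k+1}(t) w, and the means of
P_{k+1} w and q g depend only on leading coefficients and norms. Their difference has the sign of
(k+1) - b(k+n-1). -/
theorem mean_christoffel_pos {n : ℕ} (hn : 2 ≤ n) {k : ℕ} {b t : ℝ}
    (hb : b * ((k : ℝ) + n - 1) < k + 1) {w : ℝ[X]}
    (hw : quasiGegenbauer n k b = (X - C t) * w) (hwd : w.natDegree ≤ k + 1)
    (hwc : w.coeff (k + 1) = (gegenbauer n (k + 2)).coeff (k + 2)) :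
    0 < (gegenbauer n (k + 1)).eval t * mean hn w := by
  have hn' : (2 : ℝ) ≤ n := by exact_mod_cast hn
  have hk : (0 : ℝ) ≤ k := Nat.cast_nonneg k
  obtain ⟨g, hg, hgd, hgc⟩ := exists_X_sub_C_mul_eq_sub (gegenbauer n (k + 1)) t
    (m := k) (natDegree_gegenbauer hn _).le
  have h1 : mean hn (gegenbauer n (k + 1) * w) =
      b * mean hn (gegenbauer n k * g) + (gegenbauer n (k + 1)).eval t * mean hn w := by
    have e : gegenbauer n (k + 1) * w =
        gegenbauer n (k + 2) * g + C b * (gegenbauer n k * g) +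
          C ((gegenbauer n (k + 1)).eval t) * w := by
      conv_lhs => rw [hg]
      rw [quasiGegenbauer] at hw
      linear_combination (-g) * hw
    rw [e, map_add, map_add, mean_C_mul, mean_C_mul, mean_gegenbauer_mul_of_degree_lt hn, zero_add]
    exact lt_of_le_of_lt (natDegree_le_iff_degree_le.1 hgd) (by exact_mod_cast (by omega : k < k + 2))
  have h2 := mean_mul_gegenbauer_of_natDegree_le hn hwd
  have h3 := mean_mul_gegenbauer_of_natDegree_le hn hgd
  have h4 := mean_gegenbauer_sq_rec hn k
  have h5 := coeff_gegenbauer_self_succ hn k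
  rw [hwc] at h2
  rw [hgc] at h3
  have p0 := coeff_gegenbauer_self_pos hn k
  have p1 := coeff_gegenbauer_self_pos hn (k + 1)
  have N1 := mean_gegenbauer_sq_pos hn (k + 1)
  set l0 := (gegenbauer n k).coeff k
  set l1 := (gegenbauer n (k + 1)).coeff (k + 1)
  set l2 := (gegenbauer n (k + 2)).coeff (k + 2)
  set n0 := mean hn (gegenbauer n k * gegenbauer n k)
  set n1 := mean hn (gegenbauer n (k + 1) * gegenbauer n (k + 1))
  set A := mean hn (gegenbauer n (k + 1) * w)
  set B := mean hn (gegenbauer n k * g)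
  have hA : 0 < (k : ℝ) + n - 1 := by linarith
  have hB : (k + 1) * B = (2 * (k : ℝ) + n) * n1 := by
    apply mul_right_cancel₀ p0.ne'
    linear_combination (k + 1 : ℝ) * h3 - h4
  have hA' : ((k : ℝ) + n - 1) * A = (2 * (k : ℝ) + n) * n1 := by
    apply mul_right_cancel₀ p1.ne'
    linear_combination ((k : ℝ) + n - 1) * h2 + n1 * h5
  have hfin : ((k : ℝ) + n - 1) * (k + 1) * ((gegenbauer n (k + 1)).eval t * mean hn w) =
      (k + 1 - b * ((k : ℝ) + n - 1)) * ((2 * (k : ℝ) + n) * n1) := by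
    linear_combination (-((k : ℝ) + n - 1) * (k + 1)) * h1 + (k + 1 : ℝ) * hA' -
      b * ((k : ℝ) + n - 1) * hB
  refine pos_of_mul_pos_right (a := ((k : ℝ) + n - 1) * (k + 1)) ?_ (by positivity)
  rw [hfin]
  exact mul_pos (by linarith) (mul_pos (by linarith) N1)

theorem exists_positive_weights {n : ℕ} (hn : 2 ≤ n) {k : ℕ} {b : ℝ}
    (hb : b * ((k : ℝ) + n - 1) < k + 1) {x : Fin (k + 1) → ℝ} {β : Fin (k + 2) → ℝ}
    (hβ : Function.Injective β)
    (hP : gegenbauer n (k + 1) = C ((gegenbauer n (k + 1)).coeff (k + 1)) * ∏ j, (X - C (x j)))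
    (hq : quasiGegenbauer n k b = C ((gegenbauer n (k + 2)).coeff (k + 2)) * ∏ i, (X - C (β i)))
    (hxβ : ∀ i j, 0 < (β i - β (i.succAbove j)) * (β i - x j)) :
    ∃ γ : Fin (k + 2) → ℝ, (∀ i, 0 < γ i) ∧
      ∀ g r : ℝ[X], r.natDegree ≤ k + 1 → mean hn (quasiGegenbauer n k b * g) = 0 →
        mean hn (quasiGegenbauer n k b * g + r) =
          ∑ i, γ i * (quasiGegenbauer n k b * g + r).eval (β i) := by
  obtain ⟨γ, hγ⟩ := exists_interpolatory_weights hn hβ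
  have hlt : ∀ {r : ℝ[X]}, r.natDegree ≤ k + 1 → r.degree < ((k + 2 : ℕ) : WithBot ℕ) :=
    fun hr => lt_of_le_of_lt (natDegree_le_iff_degree_le.1 hr)
      (by exact_mod_cast (by omega : k + 1 < k + 2))
  have l1 := coeff_gegenbauer_self_pos hn (k + 1)
  have l2 := coeff_gegenbauer_self_pos hn (k + 2)
  have hq0 : ∀ i, (quasiGegenbauer n k b).eval (β i) = 0 := fun i => by
    rw [hq, eval_mul, eval_prod, Finset.prod_eq_zero (Finset.mem_univ i) (by simp), mul_zero]
  refine ⟨γ, fun i => ?_, fun g r hr hg => ?_⟩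
  · set p : ℝ[X] := ∏ j, (X - C (β (i.succAbove j))) with hp
    set w := C ((gegenbauer n (k + 2)).coeff (k + 2)) * p with hw
    have hpm : p.Monic := monic_prod_of_monic _ _ fun j _ => monic_X_sub_C _
    have hpd : p.natDegree = k + 1 := by
      rw [hp, natDegree_prod_of_monic _ _ fun j _ => monic_X_sub_C _]
      simp
    have hpc : p.coeff (k + 1) = 1 := by rw [← hpd]; exact hpm
    have hwd : w.natDegree ≤ k + 1 := (natDegree_C_mul_le _ _).trans hpd.le
    have hqw : quasiGegenbauer n k b = (X - C (β i)) * w := by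
      rw [hq, Fin.prod_univ_succAbove _ i, hw, hp]
      ring
    have h1 := mean_christoffel_pos hn hb hqw hwd (by rw [hw, coeff_C_mul, hpc, mul_one])
    have h2 : mean hn w = γ i * w.eval (β i) := by
      rw [hγ w (hlt hwd)]
      refine Finset.sum_eq_single i (fun j _ hj => ?_) (by simp)
      obtain ⟨j', rfl⟩ := Fin.exists_succAbove_eq hj
      rw [hw, eval_mul, hp, eval_prod, Finset.prod_eq_zero (Finset.mem_univ j') (by simp)]
      ring
    -- Interlacing gives P_{k+1} and w = q/(X - β_i) the same sign at β_i. As mean w = γ_i w(β_i),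
    -- the Christoffel identity forces γ_i > 0.
    have h3 : 0 < (gegenbauer n (k + 1)).eval (β i) * w.eval (β i) := by
      rw [hP, hw, hp]
      simp only [eval_mul, eval_C, eval_prod, eval_sub, eval_X]
      have h4 : 0 < ∏ j, (β i - β (i.succAbove j)) * (β i - x j) :=
        Finset.prod_pos fun j _ => hxβ i j
      rw [Finset.prod_mul_distrib] at h4
      have := mul_pos (mul_pos l1 l2) h4
      linarith
    rw [h2] at h1
    exact pos_of_mul_pos_left (b := (gegenbauer n (k + 1)).eval (β i) * w.eval (β i))
      (by linarith) h3.le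
  · rw [map_add, hg, zero_add, hγ r (hlt hr)]
    simp [hq0]

/-! ### Symmetry of the nodes -/

theorem rev_eq_neg_of_strictMono {m : ℕ} {β : Fin m → ℝ} (hβ : StrictMono β) {q : ℝ[X]} {c : ℝ}
    (hc : c ≠ 0) (hq : q = C c * ∏ i, (X - C (β i)))
    (hsymm : ∀ t, q.eval (-t) = (-1) ^ m * q.eval t) (i : Fin m) : β i.rev = -β i := by
  have hroot : ∀ t, q.eval t = 0 ↔ t ∈ Set.range β := by
    intro t
    rw [hq, eval_mul, eval_C, eval_prod, mul_eq_zero, or_iff_right hc, Finset.prod_eq_zero_iff]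
    simp only [Finset.mem_univ, true_and, eval_sub, eval_X, eval_C, sub_eq_zero, Set.mem_range,
      eq_comm]
  have hneg : ∀ t, q.eval (-t) = 0 ↔ q.eval t = 0 := fun t => by
    rw [hsymm, mul_eq_zero, or_iff_right (pow_ne_zero _ (by norm_num))]
  have hmono : StrictMono fun i : Fin m => -β i.rev := fun i j hij =>
    neg_lt_neg (hβ (Fin.rev_lt_rev.2 hij))
  -- Two strictly increasing enumerations of the same zero set coincide.
  have hrange : Set.range (fun i : Fin m => -β i.rev) = Set.range β := by
    ext t
    rw [← hroot, ← hneg, hroot]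
    constructor
    · rintro ⟨i, rfl⟩
      exact ⟨i.rev, by simp⟩
    · rintro ⟨i, hi⟩
      exact ⟨i.rev, by simp [hi]⟩
  have h := congrFun ((StrictMono.range_inj hmono hβ).1 hrange) i
  linarith

theorem eval_neg_quasiGegenbauer (n k : ℕ) (b t : ℝ) :
    (quasiGegenbauer n k b).eval (-t) = (-1) ^ (k + 2) * (quasiGegenbauer n k b).eval t := by
  simp only [quasiGegenbauer, eval_add, eval_mul, eval_C, eval_neg_gegenbauer]
  ring

/-! ### Exactness on the space of the Gegenbauer polynomials with index in `T^k` -/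

/-- Modulo degrees below 2k the space is spanned by P_{2k+1} and P_{2k+2}, and u, v form a
triangular system in these with nonzero diagonal. -/
theorem gegenbauerSpace_le_ker {n k : ℕ} (hn : 2 ≤ n) (hk : 1 ≤ k) (Λ : ℝ[X] →ₗ[ℝ] ℝ)
    (hlow : ∀ f : ℝ[X], f.natDegree < 2 * k → Λ f = 0) {u v : ℝ[X]}
    (hud : u.natDegree ≤ 2 * k + 1) (hu0 : u.coeff (2 * k) = 0) (hu1 : u.coeff (2 * k + 1) ≠ 0)
    (hu : Λ u = 0) (hvd : v.natDegree ≤ 2 * k + 2) (hv0 : mean hn (gegenbauer n (2 * k) * v) = 0)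
    (hv1 : v.coeff (2 * k + 2) ≠ 0) (hv : Λ v = 0) :
    gegenbauerSpace n (skipOneAddTwo k) ≤ LinearMap.ker Λ := by
  have hlow' : ∀ f ∈ degreeLT ℝ (2 * k), Λ f = 0 := fun f hf => by
    rcases eq_or_ne f 0 with rfl | h0
    · exact map_zero _
    · exact hlow f ((natDegree_lt_iff_degree_lt h0).2 (mem_degreeLT.1 hf))
  have hum : mean hn (gegenbauer n (2 * k) * u) = 0 := by
    have h := mean_mul_gegenbauer_of_natDegree_le_add_two hn (m := 2 * k) (p := u) (by omega)
    rw [hu0, coeff_eq_zero_of_natDegree_lt (p := u) (n := 2 * k + 2) (by omega)] at h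
    have := (coeff_gegenbauer_self_pos hn (2 * k)).ne'
    simpa [this] using h
  have hsplit : ∀ w : ℝ[X], w.natDegree ≤ 2 * k + 2 →
      mean hn (gegenbauer n (2 * k) * w) = 0 → ∃ x y : ℝ,
      Λ w = x * Λ (gegenbauer n (2 * k + 1)) + y * Λ (gegenbauer n (2 * k + 2)) ∧
      w.coeff (2 * k + 1) = x * (gegenbauer n (2 * k + 1)).coeff (2 * k + 1) ∧
      w.coeff (2 * k + 2) = y * (gegenbauer n (2 * k + 2)).coeff (2 * k + 2) := by
    intro w hw hwm
    have h := mem_gegenbauerSpace_of_mean_eq_zero hn hk hw hwm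
    rw [← gegenbauerSpace_skipOneAddTwo hn hk] at h
    obtain ⟨d, hd, e, he, rfl⟩ := Submodule.mem_sup.1 h
    obtain ⟨x, y, rfl⟩ := Submodule.mem_span_pair.1 he
    have hd' := degree_lt_iff_coeff_zero _ _ |>.1 (mem_degreeLT.1 hd)
    refine ⟨x, y, ?_, ?_, ?_⟩
    · simp [hlow' d hd]
    · simp only [coeff_add, coeff_smul, smul_eq_mul, hd' (2 * k + 1) (by omega),
        coeff_gegenbauer_succ_self hn (2 * k + 1)]
      ring
    · rw [coeff_add, coeff_add, coeff_smul, coeff_smul, hd' (2 * k + 2) (by omega),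
        coeff_eq_zero_of_natDegree_lt (p := gegenbauer n (2 * k + 1))
          (by rw [natDegree_gegenbauer hn]; omega)]
      simp
  have h1 : Λ (gegenbauer n (2 * k + 1)) = 0 := by
    obtain ⟨x, y, h, hx, hy⟩ := hsplit u (by omega) hum
    have hy0 : y = 0 := by
      rw [coeff_eq_zero_of_natDegree_lt (by omega)] at hy
      exact (mul_eq_zero.1 hy.symm).resolve_right (coeff_gegenbauer_self_pos hn _).ne'
    rw [hu, hy0, zero_mul, add_zero] at h
    refine (mul_eq_zero.1 h.symm).resolve_left fun hx0 => hu1 ?_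
    rw [hx, hx0, zero_mul]
  have h2 : Λ (gegenbauer n (2 * k + 2)) = 0 := by
    obtain ⟨x, y, h, hx, hy⟩ := hsplit v hvd hv0
    rw [hv, h1, mul_zero, zero_add] at h
    refine (mul_eq_zero.1 h.symm).resolve_left fun hy0 => hv1 ?_
    rw [hy, hy0, zero_mul]
  rw [← gegenbauerSpace_skipOneAddTwo hn hk]
  refine sup_le (fun f hf => hlow' f hf) (Submodule.span_le.2 ?_)
  rintro f (rfl | rfl)
  · exact h1
  · exact h2

/-- The error functional of the quadrature rule with nodes `β` and weights `γ`. -/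
def quadratureError {n : ℕ} (hn : 2 ≤ n) {l : ℕ} (β γ : Fin l → ℝ) : ℝ[X] →ₗ[ℝ] ℝ :=
  mean hn - ∑ i, γ i • Polynomial.leval (β i)

theorem quadratureError_apply {n : ℕ} (hn : 2 ≤ n) {l : ℕ} (β γ : Fin l → ℝ) (f : ℝ[X]) :
    quadratureError hn β γ f = mean hn f - ∑ i, γ i * f.eval (β i) := by
  simp [quadratureError]

theorem isPositiveQuadrature_of_le_ker {n : ℕ} (hn : 2 ≤ n) {T : Set ℕ} {l : ℕ} {β γ : Fin l → ℝ}
    (hβ : StrictMono β) (hβ1 : ∀ i, β i ∈ Ioo (-1 : ℝ) 1) (hγ : ∀ i, 0 < γ i)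
    (h : gegenbauerSpace n T ≤ LinearMap.ker (quadratureError hn β γ)) :
    IsPositiveQuadrature n T β γ := by
  refine ⟨hβ.injective, fun i => Ioo_subset_Icc_self (hβ1 i), hγ, fun f hf => ?_⟩
  have := h hf
  rw [LinearMap.mem_ker, quadratureError_apply, sub_eq_zero] at this
  rw [integral_eval_eq_mean hn, this]

/-- As in Gaussian quadrature, divide f by q: the remainder is integrated exactly by interpolation,
and the quotient has degree below d, so orthogonality applies. -/
theorem quadratureError_eq_zero_of_natDegree_lt {n : ℕ} (hn : 2 ≤ n) {l d : ℕ} {β γ : Fin l → ℝ}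
    {q : ℝ[X]} {c : ℝ} (hc : c ≠ 0) (hq : q = C c * ∏ i, (X - C (β i)))
    (hex : ∀ g r : ℝ[X], r.natDegree < l → mean hn (q * g) = 0 →
      quadratureError hn β γ (q * g + r) = 0)
    (horth : ∀ g : ℝ[X], g.degree < d → mean hn (q * g) = 0) (hl : 1 ≤ l) {f : ℝ[X]}
    (hf : f.natDegree < l + d) : quadratureError hn β γ f = 0 := by
  set Q : ℝ[X] := ∏ i, (X - C (β i)) with hQ
  have hQm : Q.Monic := monic_prod_of_monic _ _ fun j _ => monic_X_sub_C _
  have hQd : Q.natDegree = l := by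
    rw [hQ, natDegree_prod_of_monic _ _ fun j _ => monic_X_sub_C _]
    simp
  have hfe : f = q * (C c⁻¹ * (f /ₘ Q)) + f %ₘ Q := by
    conv_lhs => rw [← modByMonic_add_div f Q]
    rw [hq, show C c * Q * (C c⁻¹ * (f /ₘ Q)) = C (c * c⁻¹) * (Q * (f /ₘ Q)) by
      rw [C_mul]; ring, mul_inv_cancel₀ hc, C_1, one_mul, add_comm]
  rw [hfe]
  refine hex _ _ ?_ (horth _ ?_)
  · have := natDegree_modByMonic_lt f hQm (by
      intro h
      rw [h, natDegree_one] at hQd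
      omega)
    omega
  · rw [degree_C_mul (inv_ne_zero hc)]
    rcases eq_or_ne (f /ₘ Q) 0 with h0 | h0
    · rw [h0, degree_zero]
      exact WithBot.bot_lt_coe _
    · rw [← natDegree_lt_iff_degree_lt h0, natDegree_divByMonic _ hQm, hQd]
      by_contra hd
      exact h0 ((divByMonic_eq_zero_iff hQm).2 (degree_lt_degree (by omega)))

theorem coeff_eq_zero_of_comp_neg_X {p : ℝ[X]} {d j : ℕ} (hp : p.comp (-X) = (-1) ^ d * p)
    (hj : Odd (d + j)) : p.coeff j = 0 := by
  have h := congrArg (fun p => p.coeff j) hp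
  have e : ((-1 : ℝ[X]) ^ d) = C ((-1 : ℝ) ^ d) := by simp
  rw [show (-X : ℝ[X]) = C (-1) * X by simp] at h
  simp only [e, coeff_C_mul, comp_C_mul_X_coeff] at h
  rcases neg_one_pow_eq_or ℝ d with hd | hd <;> rcases neg_one_pow_eq_or ℝ j with hj' | hj' <;>
    have h3 := hj.neg_one_pow (α := ℝ) <;> rw [pow_add, hd, hj'] at h3 <;>
    rw [hd, hj'] at h <;> linarith

theorem quasiGegenbauer_comp_neg_X (n k : ℕ) (b : ℝ) :
    (quasiGegenbauer n k b).comp (-X) = (-1) ^ k * quasiGegenbauer n k b := by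
  simp only [quasiGegenbauer, add_comp, mul_comp, C_comp, gegenbauer_comp_neg_X]
  ring

/-! ### Lower interpolants at symmetric nodes -/

theorem exists_lower_hermite_interpolant_of_symmetric {l : ℕ} (hl : 2 ≤ l) {β : Fin l → ℝ}
    (hβ : StrictMono β) (hβ1 : ∀ i, β i ∈ Ioo (-1 : ℝ) 1) (hrev : ∀ i, β i.rev = -β i)
    {h : ℝ → ℝ≥0∞} (hh : IsAbsolutelyMonotonePotential h) :
    ∃ H : ℝ[X], H.natDegree < 2 * l ∧ (∀ i, H.eval (β i) = (h (β i)).toReal) ∧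
      0 ≤ H.coeff (2 * l - 2) ∧ ∀ x ∈ Ioo (-1 : ℝ) 1, H.eval x ≤ (h x).toReal := by
  classical
  have hcard : (Finset.univ.image β).card = l := by
    rw [Finset.card_image_of_injective _ hβ.injective, Finset.card_univ, Fintype.card_fin]
  have hsum : ∑ x ∈ Finset.univ.image β, x = 0 := by
    rw [Finset.sum_image hβ.injective.injOn]
    have h1 : ∑ i, β (Fin.revPerm i) = ∑ i, β i := Equiv.sum_comp Fin.revPerm β
    simp only [Fin.revPerm_apply, hrev, Finset.sum_neg_distrib] at h1
    linarith
  set i₀ : Fin l := ⟨0, by omega⟩ with hi₀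
  have hpos : 0 ≤ β i₀.rev := by
    have h1 : β i₀ ≤ β i₀.rev := hβ.monotone (by rw [Fin.le_def]; exact Nat.zero_le _)
    have h2 := hrev i₀
    linarith
  obtain ⟨H, h1, h2, h3, h4⟩ := hh.nonnegDerivatives.exists_lower_hermite_interpolant
    (S := Finset.univ.image β) (by simpa using hβ1) (by omega) hsum
    (Finset.mem_image_of_mem β (Finset.mem_univ i₀.rev)) hpos
  rw [hcard] at h1 h3
  simp only [iteratedDerivWithin_zero] at h2 h4
  exact ⟨H, h1, fun i => h2 _ (Finset.mem_image_of_mem β (Finset.mem_univ i)), h3, h4⟩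

theorem hasLowerInterpolants_of_forall_exists {n : ℕ} {T : Set ℕ} {l : ℕ} {β : Fin l → ℝ}
    (hβ1 : ∀ i, β i ∈ Ioo (-1 : ℝ) 1)
    (H : ∀ h : ℝ → ℝ≥0∞, IsAbsolutelyMonotonePotential h → ∃ f ∈ gegenbauerSpace n T,
      (∀ i, f.eval (β i) = (h (β i)).toReal) ∧ ∀ x ∈ Ioo (-1 : ℝ) 1, f.eval x ≤ (h x).toReal) :
    HasLowerInterpolants n T β := by
  intro h hh
  obtain ⟨f, hf, h1, h2⟩ := H h hh
  refine ⟨f, ⟨hf, hh.eval_le h2⟩, fun i => ?_⟩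
  rw [h1 i, EReal.coe_ennreal_toReal (hh.finite _ (Ioo_subset_Ico_self (hβ1 i)))]

theorem hasLowerInterpolants_of_card_le {n k : ℕ} (hn : 2 ≤ n) (hk : 1 ≤ k) {l : ℕ} (hl : 2 ≤ l)
    (hlk : l ≤ k) {β : Fin l → ℝ} (hβ : StrictMono β) (hβ1 : ∀ i, β i ∈ Ioo (-1 : ℝ) 1)
    (hrev : ∀ i, β i.rev = -β i) : HasLowerInterpolants n (skipOneAddTwo k) β := by
  refine hasLowerInterpolants_of_forall_exists hβ1 fun h hh => ?_
  obtain ⟨H, h1, h2, -, h4⟩ := exists_lower_hermite_interpolant_of_symmetric hl hβ hβ1 hrev hh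
  refine ⟨H, ?_, h2, h4⟩
  rw [← gegenbauerSpace_skipOneAddTwo hn hk]
  refine Submodule.mem_sup_left (mem_degreeLT.2 (lt_of_le_of_lt degree_le_natDegree ?_))
  exact_mod_cast (by omega : H.natDegree < 2 * k)

theorem hasLowerInterpolants_of_mean_pos {n k : ℕ} (hn : 2 ≤ n) (hk : 1 ≤ k)
    {β : Fin (k + 1) → ℝ} (hβ : StrictMono β) (hβ1 : ∀ i, β i ∈ Ioo (-1 : ℝ) 1)
    (hrev : ∀ i, β i.rev = -β i) {q : ℝ[X]} (hqd : q.natDegree ≤ k + 1)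
    (hq : ∀ i, q.eval (β i) = 0) (hpos : 0 < mean hn (gegenbauer n (2 * k) * (q * q))) :
    HasLowerInterpolants n (skipOneAddTwo k) β := by
  refine hasLowerInterpolants_of_forall_exists hβ1 fun h hh => ?_
  obtain ⟨H, h1, h2, h3, h4⟩ :=
    exists_lower_hermite_interpolant_of_symmetric (by omega) hβ hβ1 hrev hh
  have hH : 0 ≤ mean hn (gegenbauer n (2 * k) * H) := by
    have h5 := mean_mul_gegenbauer_of_natDegree_le_add_two hn (m := 2 * k) (p := H) (by omega)
    rw [coeff_eq_zero_of_natDegree_lt (p := H) (n := 2 * k + 2) (by omega), mul_zero, add_zero] at h5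
    rw [show 2 * (k + 1) - 2 = 2 * k by omega] at h3
    have h6 := mul_nonneg h3 (mean_gegenbauer_sq_pos hn (2 * k)).le
    rw [← h5] at h6
    exact nonneg_of_mul_nonneg_left h6 (coeff_gegenbauer_self_pos hn _)
  -- This multiple of q² cancels the P_{2k} component of H; its sign is what preserves the
  -- inequality with h.
  set c := mean hn (gegenbauer n (2 * k) * H) / mean hn (gegenbauer n (2 * k) * (q * q)) with hc
  have hc0 : 0 ≤ c := div_nonneg hH hpos.le
  refine ⟨H - C c * (q * q), ?_, fun i => ?_, fun x hx => ?_⟩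
  · refine mem_gegenbauerSpace_of_mean_eq_zero hn hk ?_ ?_
    · refine (natDegree_sub_le _ _).trans (max_le (by omega) ?_)
      refine (natDegree_C_mul_le _ _).trans (natDegree_mul_le.trans (by omega))
    · rw [mul_sub, map_sub, mul_left_comm, mean_C_mul, hc, div_mul_cancel₀ _ hpos.ne', sub_self]
  · simp [hq i, h2 i]
  · have := h4 x hx
    have := mul_nonneg hc0 (mul_self_nonneg (q.eval x))
    simp only [eval_sub, eval_mul, eval_C]
    linarith

/-! ### The coefficient of `P_{2m+2}` in a product of quasi-Gegenbauer polynomials -/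

theorem mean_gegenbauer_mul_quasiGegenbauer_mul {n : ℕ} (hn : 2 ≤ n) (m : ℕ) (b c : ℝ) :
    mean hn (gegenbauer n (2 * m + 2) * (quasiGegenbauer n m b * quasiGegenbauer n m c)) *
        (gegenbauer n (2 * m + 2)).coeff (2 * m + 2) =
      (gegenbauer n (m + 2)).coeff (m + 2) * ((b + c) * (gegenbauer n m).coeff m +
          ((2 * m + 4) * (2 * m + 3) / (2 * (n + 2 * (2 * m + 2))) -
            2 * ((m + 2) * (m + 1) / (2 * (n + 2 * m)))) * (gegenbauer n (m + 2)).coeff (m + 2)) *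
        mean hn (gegenbauer n (2 * m + 2) * gegenbauer n (2 * m + 2)) := by
  have hd := natDegree_quasiGegenbauer_le hn m
  have h1 := mean_mul_gegenbauer_of_natDegree_le_add_two hn (m := 2 * m + 2)
    (p := quasiGegenbauer n m b * quasiGegenbauer n m c)
    (natDegree_mul_le.trans (by have := hd b; have := hd c; omega))
  have h2 : (quasiGegenbauer n m b * quasiGegenbauer n m c).coeff (2 * m + 2 + 2) =
      (gegenbauer n (m + 2)).coeff (m + 2) * (gegenbauer n (m + 2)).coeff (m + 2) := by
    rw [show 2 * m + 2 + 2 = (m + 2) + (m + 2) by ring, coeff_mul_add_eq_of_natDegree_le (hd b) (hd c),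
      coeff_quasiGegenbauer hn, coeff_quasiGegenbauer hn]
  have h3 := coeff_mul_add_add_two (hd b) (hd c)
  have h4 : ∀ b, (quasiGegenbauer n m b).coeff (m + 1) = 0 := fun b =>
    coeff_eq_zero_of_comp_neg_X (quasiGegenbauer_comp_neg_X n m b) ⟨m, by ring⟩
  have h5 : ∀ b, (quasiGegenbauer n m b).coeff m = -((m + 2) * (m + 1) / (2 * (n + 2 * m)) *
      (gegenbauer n (m + 2)).coeff (m + 2)) + b * (gegenbauer n m).coeff m := fun b => by
    rw [quasiGegenbauer, coeff_add, coeff_C_mul, coeff_gegenbauer_sub_two hn]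
  rw [h4, h4, h5, h5, coeff_quasiGegenbauer hn, coeff_quasiGegenbauer hn,
    show m + m + 2 = 2 * m + 2 by ring] at h3
  rw [h1, h2, h3]
  push_cast
  ring

/-! ### The skip one, add two quadrature rule -/

/-- The hypotheses on `b` and `c` under which the zeros of `P_{m+2} + b P_m` are the nodes of a
skip one, add two quadrature rule. -/
structure IsSkipPair {n : ℕ} (hn : 2 ≤ n) (m : ℕ) (b c : ℝ) : Prop where
  pos : 0 < b
  lt : c < b
  bound : b * ((m : ℝ) + n - 1) < m + 1
  norm : mean hn (gegenbauer n (m + 2) * gegenbauer n (m + 2)) +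
    b * c * mean hn (gegenbauer n m * gegenbauer n m) = 0
  skip : (b + c) * (gegenbauer n m).coeff m +
    ((2 * m + 4) * (2 * m + 3) / (2 * (n + 2 * (2 * m + 2))) -
      2 * ((m + 2) * (m + 1) / (2 * (n + 2 * m)))) * (gegenbauer n (m + 2)).coeff (m + 2) = 0

theorem IsSkipPair.mean_sq_pos {n : ℕ} {hn : 2 ≤ n} {m : ℕ} {b c : ℝ} (h : IsSkipPair hn m b c) :
    0 < mean hn (gegenbauer n (2 * m + 2) * (quasiGegenbauer n m b * quasiGegenbauer n m b)) := by
  have h1 := mean_gegenbauer_mul_quasiGegenbauer_mul hn m b b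
  have h2 := h.skip
  have p0 := coeff_gegenbauer_self_pos hn m
  have p2 := coeff_gegenbauer_self_pos hn (m + 2)
  have p3 := coeff_gegenbauer_self_pos hn (2 * m + 2)
  have N := mean_gegenbauer_sq_pos hn (2 * m + 2)
  refine pos_of_mul_pos_left (b := (gegenbauer n (2 * m + 2)).coeff (2 * m + 2)) ?_ p3.le
  rw [h1]
  refine mul_pos (mul_pos p2 ?_) N
  -- Replacing c by b raises the vanishing expression of `h.skip` by (b - c) times the leading
  -- coefficient of P_m.
  have := mul_pos (sub_pos.2 h.lt) p0
  linarith

theorem IsSkipPair.mean_mul_eq_zero {n : ℕ} {hn : 2 ≤ n} {m : ℕ} {b c : ℝ}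
    (h : IsSkipPair hn m b c) : mean hn (quasiGegenbauer n m b * quasiGegenbauer n m c) = 0 := by
  have e : quasiGegenbauer n m b * quasiGegenbauer n m c =
      gegenbauer n (m + 2) * gegenbauer n (m + 2) + C (b + c) * (gegenbauer n (m + 2) * gegenbauer n m)
        + C (b * c) * (gegenbauer n m * gegenbauer n m) := by
    simp only [quasiGegenbauer, C_add, C_mul]
    ring
  rw [e, map_add, map_add, mean_C_mul, mean_C_mul,
    mean_gegenbauer_mul_of_ne hn (show m + 2 ≠ m by omega)]
  linarith [h.norm]

theorem IsSkipPair.gegenbauerSpace_le_ker {n : ℕ} {hn : 2 ≤ n} {m : ℕ} {b c : ℝ}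
    (h : IsSkipPair hn m b c) {β γ : Fin (m + 2) → ℝ}
    (hq : quasiGegenbauer n m b = C ((gegenbauer n (m + 2)).coeff (m + 2)) * ∏ i, (X - C (β i)))
    (hex : ∀ g r : ℝ[X], r.natDegree < m + 2 → mean hn (quasiGegenbauer n m b * g) = 0 →
      quadratureError hn β γ (quasiGegenbauer n m b * g + r) = 0) :
    gegenbauerSpace n (skipOneAddTwo (m + 1)) ≤ LinearMap.ker (quadratureError hn β γ) := by
  have p1 := (coeff_gegenbauer_self_pos hn (m + 1)).ne'
  have p2 := (coeff_gegenbauer_self_pos hn (m + 2)).ne'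
  have hd := natDegree_quasiGegenbauer_le hn m
  have hd1 := (natDegree_gegenbauer hn (m + 1)).le
  have hex' : ∀ g : ℝ[X], mean hn (quasiGegenbauer n m b * g) = 0 →
      quadratureError hn β γ (quasiGegenbauer n m b * g) = 0 := fun g hg => by
    simpa using hex g 0 (by simp) hg
  refine SkipOneAddTwo.gegenbauerSpace_le_ker hn (by omega) _ (fun f hf => ?_)
    (u := quasiGegenbauer n m b * gegenbauer n (m + 1)) ?_ ?_ ?_ ?_
    (v := quasiGegenbauer n m b * quasiGegenbauer n m c) ?_ ?_ ?_ ?_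
  · exact quadratureError_eq_zero_of_natDegree_lt hn (d := m) p2 hq hex
      (fun g hg => mean_quasiGegenbauer_mul_eq_zero hn hg) (by omega) (by omega)
  · exact natDegree_mul_le.trans (by have := hd b; omega)
  · refine coeff_eq_zero_of_comp_neg_X (d := 2 * m + 1) ?_ ⟨2 * m + 1, by ring⟩
    rw [mul_comp, quasiGegenbauer_comp_neg_X, gegenbauer_comp_neg_X]
    ring
  · rw [show 2 * (m + 1) + 1 = m + 2 + (m + 1) by ring, coeff_mul_add_eq_of_natDegree_le (hd b) hd1,
      coeff_quasiGegenbauer hn]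
    exact mul_ne_zero p2 p1
  · refine hex' _ ?_
    rw [quasiGegenbauer, add_mul, map_add, mul_assoc, mean_C_mul,
      mean_gegenbauer_mul_of_ne hn (by omega), mean_gegenbauer_mul_of_ne hn (by omega)]
    ring
  · exact natDegree_mul_le.trans (by have := hd b; have := hd c; omega)
  · have h1 := mean_gegenbauer_mul_quasiGegenbauer_mul hn m b c
    rw [h.skip, mul_zero, zero_mul] at h1
    exact (mul_eq_zero.1 h1).resolve_right (coeff_gegenbauer_self_pos hn _).ne'
  · rw [show 2 * (m + 1) + 2 = m + 2 + (m + 2) by ring, coeff_mul_add_eq_of_natDegree_le (hd b) (hd c),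
      coeff_quasiGegenbauer hn, coeff_quasiGegenbauer hn]
    exact mul_ne_zero p2 p2
  · exact hex' _ h.mean_mul_eq_zero

/-! ### Positive Gegenbauer coefficients after removing the largest node -/

theorem gegenbauerCoeff_pos_of_mean_pos {n : ℕ} (hn : 2 ≤ n) {f : ℝ[X]} {i : ℕ}
    (h : 0 < mean hn (gegenbauer n i * f)) : 0 < gegenbauerCoeff n f i := by
  refine div_pos ?_ ?_
  · simp_rw [← eval_mul]
    rw [integral_eval_eq_mean hn, mul_comm]
    exact h
  · simp_rw [pow_two, ← eval_mul]
    rw [integral_eval_eq_mean hn]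
    exact mean_gegenbauer_sq_pos hn i

/-- For i ≤ m, writing P_i = (X - t) g + P_i(t) gives mean(P_i w) = P_i(t) mean(w), because q is
orthogonal to g. The top index i = m+1 falls outside this range of orthogonality and is read off
from leading coefficients. -/
theorem mean_gegenbauer_mul_pos_of_mul_eq_quasiGegenbauer {n : ℕ} (hn : 2 ≤ n) {m : ℕ} {b t : ℝ}
    (hb : b * ((m : ℝ) + n - 1) < m + 1) {w : ℝ[X]}
    (hw : quasiGegenbauer n m b = (X - C t) * w) (hwd : w.natDegree ≤ m + 1)
    (hwc : w.coeff (m + 1) = (gegenbauer n (m + 2)).coeff (m + 2))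
    (ht : ∀ j ≤ m + 1, 0 < (gegenbauer n j).eval t) {i : ℕ} (hi : i ≤ m + 1) :
    0 < mean hn (gegenbauer n i * w) := by
  rcases eq_or_lt_of_le hi with rfl | hi
  · have h1 := mean_mul_gegenbauer_of_natDegree_le hn hwd
    refine pos_of_mul_pos_left (b := (gegenbauer n (m + 1)).coeff (m + 1)) ?_
      (coeff_gegenbauer_self_pos hn _).le
    rw [h1, hwc]
    exact mul_pos (coeff_gegenbauer_self_pos hn _) (mean_gegenbauer_sq_pos hn _)
  · have hw0 : 0 < mean hn w := pos_of_mul_pos_right (mean_christoffel_pos hn hb hw hwd hwc)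
      (ht _ le_rfl).le
    rcases i with _ | i
    · simpa [gegenbauer] using hw0
    · obtain ⟨g, hg, hgd, -⟩ := exists_X_sub_C_mul_eq_sub (gegenbauer n (i + 1)) t (m := i)
        (natDegree_gegenbauer hn _).le
      have e : gegenbauer n (i + 1) * w = quasiGegenbauer n m b * g +
          C ((gegenbauer n (i + 1)).eval t) * w := by
        conv_lhs => rw [hg]
        rw [hw]
        ring
      rw [e, map_add, mean_C_mul, mean_quasiGegenbauer_mul_eq_zero hn, zero_add]
      · exact mul_pos (ht _ (by omega)) hw0
      · exact lt_of_le_of_lt (natDegree_le_iff_degree_le.1 hgd)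
          (by exact_mod_cast (by omega : i < m))

theorem IsSkipPair.exists_nodes {n : ℕ} {hn : 2 ≤ n} {m : ℕ} {b c : ℝ} (h : IsSkipPair hn m b c) :
    ∃ β : Fin (m + 2) → ℝ, StrictMono β ∧ (∀ i, β i ∈ Ioo (-1 : ℝ) 1) ∧
      (∀ i, β i.rev = -β i) ∧
      quasiGegenbauer n m b = C ((gegenbauer n (m + 2)).coeff (m + 2)) * ∏ i, (X - C (β i)) ∧
      (∃ γ : Fin (m + 2) → ℝ, IsPositiveQuadrature n (skipOneAddTwo (m + 1)) β γ) ∧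
      (∀ i ≤ m + 1, 0 < gegenbauerCoeff n (∏ j : Fin (m + 1), (X - C (β j.castSucc))) i) ∧
      HasLowerInterpolants n (skipOneAddTwo (m + 1)) β := by
  obtain ⟨x, β, hβ, hβ1, hP, hq, hxβ, hpos⟩ := exists_nodes_quasiGegenbauer hn m h.pos.le h.bound
  have p2 := coeff_gegenbauer_self_pos hn (m + 2)
  have hrev := rev_eq_neg_of_strictMono hβ p2.ne' hq (eval_neg_quasiGegenbauer n m b)
  obtain ⟨γ, hγ, hex⟩ := exists_positive_weights hn h.bound hβ.injective hP hq hxβ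
  refine ⟨β, hβ, hβ1, hrev, hq, ⟨γ, isPositiveQuadrature_of_le_ker hn hβ hβ1 hγ
    (h.gegenbauerSpace_le_ker hq fun g r hr hg => ?_)⟩, fun i hi => ?_,
    hasLowerInterpolants_of_mean_pos hn (by omega) hβ hβ1 hrev
      (natDegree_quasiGegenbauer_le hn m b) (fun i => ?_) h.mean_sq_pos⟩
  · rw [quadratureError_apply, hex g r (by omega) hg, sub_self]
  · refine gegenbauerCoeff_pos_of_mean_pos hn ?_
    set p : ℝ[X] := ∏ j : Fin (m + 1), (X - C (β j.castSucc)) with hp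
    have hpm : p.Monic := monic_prod_of_monic _ _ fun j _ => monic_X_sub_C _
    have hpd : p.natDegree = m + 1 := by
      rw [hp, natDegree_prod_of_monic _ _ fun j _ => monic_X_sub_C _]
      simp
    have hpc : p.coeff (m + 1) = 1 := by rw [← hpd]; exact hpm
    have h1 := mean_gegenbauer_mul_pos_of_mul_eq_quasiGegenbauer hn h.bound
      (t := β (Fin.last (m + 1))) (w := C ((gegenbauer n (m + 2)).coeff (m + 2)) * p)
      (by rw [hq, Fin.prod_univ_castSucc, hp]; ring) ((natDegree_C_mul_le _ _).trans hpd.le)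
      (by rw [coeff_C_mul, hpc, mul_one]) hpos hi
    rw [mul_left_comm, mean_C_mul] at h1
    exact pos_of_mul_pos_right h1 p2.le
  · rw [hq, eval_mul, eval_prod, Finset.prod_eq_zero (Finset.mem_univ i) (by simp), mul_zero]

/-! ### The system for `b` and `c` -/

/-- Shifted down by one so that it also covers m = 0, where both sides are n - 2; its factors are
those of the Pochhammer symbols. -/
theorem coeff_gegenbauer_self_rec {n : ℕ} (hn : 2 ≤ n) (m : ℕ) :
    ((m : ℝ) + n - 2) * (gegenbauer n (m + 1)).coeff (m + 1) =
      (2 * (m : ℝ) + n - 2) * (gegenbauer n m).coeff m := by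
  rcases m with _ | m
  · simp [gegenbauer]
  · have h := coeff_gegenbauer_self_succ hn m
    push_cast
    linear_combination h

theorem coeff_gegenbauer_self_mul_ascPochhammer {n : ℕ} (hn : 3 ≤ n) (m : ℕ) :
    (gegenbauer n m).coeff m = (ascPochhammer ℝ m).eval ((n : ℝ) / 2 - 1) * 2 ^ m /
      (ascPochhammer ℝ m).eval (2 * ((n : ℝ) / 2 - 1)) := by
  have hn' : (3 : ℝ) ≤ n := by exact_mod_cast hn
  rw [eq_div_iff (ascPochhammer_pos m _ (by linarith)).ne']
  induction m with
  | zero => simp [gegenbauer]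
  | succ m ih =>
    rw [ascPochhammer_succ_eval, ascPochhammer_succ_eval, pow_succ]
    have h := coeff_gegenbauer_self_rec (by omega : 2 ≤ n) m
    linear_combination (ascPochhammer ℝ m).eval (2 * ((n : ℝ) / 2 - 1)) * h +
      (2 * (m : ℝ) + n - 2) * ih

theorem mean_gegenbauer_sq_succ {n : ℕ} (hn : 2 ≤ n) (m : ℕ) :
    (2 * (m : ℝ) + n) * (m + n - 2) * mean hn (gegenbauer n (m + 1) * gegenbauer n (m + 1)) =
      (m + 1) * (2 * m + n - 2) * mean hn (gegenbauer n m * gegenbauer n m) := by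
  have h1 := mean_gegenbauer_sq_rec hn m
  have h2 := coeff_gegenbauer_self_rec hn m
  apply mul_left_cancel₀ (coeff_gegenbauer_self_pos hn m).ne'
  linear_combination ((m : ℝ) + n - 2) * h1 +
    ((m : ℝ) + 1) * mean hn (gegenbauer n m * gegenbauer n m) * h2

/-- The quadratic with roots b and c is positive at k/(2a+k), by the closed form in `key`. The
factor containing c is positive there, hence so is the other. -/
theorem lt_of_vieta {a k b c : ℝ} (ha : 0 < a) (hk : 1 ≤ k) (hc : c < 0)
    (hp : b * c = -((k + 1) * k * (a + k - 1)) / ((2 * a + k) * (2 * a + k - 1) * (a + k + 1)))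
    (hs : b + c = -(2 * a * (k + 1) ^ 2 * (a + k - 1)) /
      ((2 * a + k) * (2 * a + k - 1) * (a + 2 * k + 1))) : b < k / (2 * a + k) := by
  have h1 : 0 < 2 * a + k := by linarith
  have h2 : 0 < 2 * a + k - 1 := by linarith
  have h3 : 0 < a + k + 1 := by linarith
  have h4 : 0 < a + 2 * k + 1 := by linarith
  have hB : 0 < k / (2 * a + k) := div_pos (by linarith) h1
  have key : (k / (2 * a + k) - b) * (k / (2 * a + k) - c) =
      2 * k ^ 2 * (k + 2) * a * (a + k) ^ 2 /
        ((2 * a + k) ^ 2 * (2 * a + k - 1) * (a + k + 1) * (a + 2 * k + 1)) := by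
    have e : (k / (2 * a + k) - b) * (k / (2 * a + k) - c) =
        (k / (2 * a + k)) ^ 2 - (b + c) * (k / (2 * a + k)) + b * c := by ring
    rw [e, hp, hs]
    field_simp
    ring
  have hpos : 0 < (k / (2 * a + k) - b) * (k / (2 * a + k) - c) := by
    rw [key]
    positivity
  exact sub_pos.1 (pos_of_mul_pos_left hpos (by linarith))

theorem isSkipPair_of_isSystemSolution {n m : ℕ} (hn : 2 ≤ n) (hn3 : 3 ≤ n) {b c : ℝ} (hb : 0 < b)
    (hc : c < 0) (h : IsSystemSolution n (m + 1) b c) : IsSkipPair hn m b c := by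
  have hn' : (3 : ℝ) ≤ n := by exact_mod_cast hn3
  have hm : (0 : ℝ) ≤ m := Nat.cast_nonneg m
  obtain ⟨hp, hs⟩ := h
  push_cast at hp hs
  have hlt := lt_of_vieta (by linarith) (by linarith) hc hp hs
  have n1 : (m : ℝ) + n - 2 ≠ 0 := by linarith
  have n2 : (m : ℝ) + n - 1 ≠ 0 := by linarith
  have n3 : 2 * (m : ℝ) + n ≠ 0 := by linarith
  have n4 : 2 * (m : ℝ) + n + 2 ≠ 0 := by linarith
  have n5 : (n : ℝ) + 2 * m ≠ 0 := by linarith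
  have n6 : (n : ℝ) + 2 * (2 * m + 2) ≠ 0 := by linarith
  refine ⟨hb, hc.trans hb, ?_, ?_, ?_⟩
  · rw [lt_div_iff₀ (by linarith)] at hlt
    linarith
  · have h1 := mean_gegenbauer_sq_succ hn m
    have h2 := mean_gegenbauer_sq_succ hn (m + 1)
    push_cast at h2
    have e1 : mean hn (gegenbauer n (m + 1) * gegenbauer n (m + 1)) =
        (m + 1) * (2 * m + n - 2) * mean hn (gegenbauer n m * gegenbauer n m) /
          ((2 * m + n) * (m + n - 2)) := by
      rw [eq_div_iff (mul_ne_zero n3 n1)]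
      linarith
    have e2 : mean hn (gegenbauer n (m + 2) * gegenbauer n (m + 2)) =
        (m + 2) * (2 * m + n) * mean hn (gegenbauer n (m + 1) * gegenbauer n (m + 1)) /
          ((2 * m + n + 2) * (m + n - 1)) := by
      rw [eq_div_iff (mul_ne_zero n4 n2)]
      linear_combination h2
    have e3 : b * c = -((m + 2) * (m + 1) * (2 * m + n - 2)) /
        ((m + n - 1) * (m + n - 2) * (2 * m + n + 2)) := by
      rw [hp, show 2 * ((n : ℝ) / 2 - 1) + (m + 1) = m + n - 1 by ring,
        show (m : ℝ) + n - 1 - 1 = m + n - 2 by ring,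
        show (n : ℝ) / 2 - 1 + (m + 1) + 1 = (2 * m + n + 2) / 2 by ring,
        show (n : ℝ) / 2 - 1 + (m + 1) - 1 = (2 * m + n - 2) / 2 by ring]
      field_simp
      ring
    rw [e2, e1, e3]
    field_simp
    ring
  · have h1 := coeff_gegenbauer_self_rec hn m
    have h2 := coeff_gegenbauer_self_succ hn m
    have e1 : (gegenbauer n (m + 1)).coeff (m + 1) =
        (2 * m + n - 2) * (gegenbauer n m).coeff m / (m + n - 2) := by
      rw [eq_div_iff n1]
      linarith
    have e2 : (gegenbauer n (m + 2)).coeff (m + 2) =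
        (2 * m + n) * (gegenbauer n (m + 1)).coeff (m + 1) / (m + n - 1) := by
      rw [eq_div_iff n2]
      linarith
    have e3 : b + c = -(2 * (n - 2) * (m + 2) ^ 2 * (2 * m + n - 2)) /
        (2 * ((m + n - 1) * (m + n - 2) * (4 * m + n + 4))) := by
      have n7 : 4 * (m : ℝ) + n + 4 ≠ 0 := by linarith
      rw [hs, show 2 * ((n : ℝ) / 2 - 1) + (m + 1) = m + n - 1 by ring,
        show (m : ℝ) + n - 1 - 1 = m + n - 2 by ring,
        show (n : ℝ) / 2 - 1 + 2 * (m + 1) + 1 = (4 * m + n + 4) / 2 by ring,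
        show (n : ℝ) / 2 - 1 + (m + 1) - 1 = (2 * m + n - 2) / 2 by ring,
        show 2 * ((n : ℝ) / 2 - 1) = n - 2 by ring]
      field_simp
      ring
    have n7 : (n : ℝ) + 4 * m + 4 ≠ 0 := by linarith
    rw [e2, e1, e3, show 4 * (m : ℝ) + n + 4 = n + 4 * m + 4 by ring,
      show (n : ℝ) + 2 * (2 * m + 2) = n + 4 * m + 4 by ring,
      show 2 * (m : ℝ) + n = n + 2 * m by ring]
    field_simp
    ring

/-- A negative product makes the discriminant exceed s², so the roots are real with opposite signs,
and the sign condition fixes their order. -/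
theorem existsUnique_of_vieta {p s : ℝ} (hp : p < 0) :
    ∃! bc : ℝ × ℝ, 0 < bc.1 ∧ bc.2 < 0 ∧ bc.1 * bc.2 = p ∧ bc.1 + bc.2 = s := by
  have hD : s ^ 2 < s ^ 2 - 4 * p := by linarith
  have hD0 : 0 ≤ s ^ 2 - 4 * p := by nlinarith [sq_nonneg s]
  have hsq := Real.sq_sqrt hD0
  have habs := abs_lt_of_sq_lt_sq' (hD.trans_eq hsq.symm) (Real.sqrt_nonneg _)
  refine ⟨((s + √(s ^ 2 - 4 * p)) / 2, (s - √(s ^ 2 - 4 * p)) / 2), ⟨?_, ?_, ?_, ?_⟩, ?_⟩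
  · simp only
    linarith [habs.1]
  · simp only
    linarith [habs.2]
  · simp only
    linear_combination (-1 / 4 : ℝ) * hsq
  · simp only
    ring
  · rintro ⟨b, c⟩ ⟨hb, hc, hbc, hs⟩
    simp only at hb hc hbc hs
    have h1 : √(s ^ 2 - 4 * p) = b - c := by
      rw [show s ^ 2 - 4 * p = (b - c) ^ 2 by rw [← hs, ← hbc]; ring]
      exact Real.sqrt_sq (by linarith)
    rw [h1, ← hs]
    ext <;> simp only <;> ring

theorem existsUnique_isSystemSolution {n k : ℕ} (hn : 3 ≤ n) (hk : 1 ≤ k) :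
    ∃! bc : ℝ × ℝ, 0 < bc.1 ∧ bc.2 < 0 ∧ IsSystemSolution n k bc.1 bc.2 := by
  have hn' : (3 : ℝ) ≤ n := by exact_mod_cast hn
  have hk' : (1 : ℝ) ≤ k := by exact_mod_cast hk
  refine existsUnique_of_vieta (div_neg_of_neg_of_pos (neg_neg_of_pos ?_) ?_)
  · exact mul_pos (by positivity) (by linarith)
  · exact mul_pos (mul_pos (by linarith) (by linarith)) (by linarith)

/-! ### The circle -/

theorem isSkipPair_two_zero (hn : 2 ≤ 2) : IsSkipPair hn 0 (√2)⁻¹ (-(√2)⁻¹) := by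
  have h2 : (√2 : ℝ)⁻¹ * (√2)⁻¹ = 1 / 2 := by
    rw [← mul_inv, Real.mul_self_sqrt (by norm_num)]
    norm_num
  have hpos : (0 : ℝ) < (√2)⁻¹ := by positivity
  refine ⟨hpos, by linarith, ?_, ?_, ?_⟩
  · norm_num
    nlinarith
  · have h3 := mean_gegenbauer_sq_rec hn 0
    have h4 := mean_gegenbauer_sq_rec hn 1
    have c2 := coeff_gegenbauer_self_succ hn 0
    have c0 : (gegenbauer 2 0).coeff 0 = 1 := by simp [gegenbauer]
    have c1 : (gegenbauer 2 1).coeff 1 = 1 := by simp [gegenbauer]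
    norm_num [c0, c1] at h3 h4 c2
    rw [c2] at h4
    norm_num
    rw [h2]
    linarith
  · have c2 := coeff_gegenbauer_self_succ hn 0
    have c1 : (gegenbauer 2 1).coeff 1 = 1 := by simp [gegenbauer]
    norm_num

/-- On the circle P_k P_{k+2} is half of P_{2k+2} + P_2 and so has no P_{2k} component. Gauss
quadrature at the k zeros of P_k therefore extends to the skipped space, tested on P_k P_{k+1} and
P_k P_{k+2}. -/
theorem isPULBSpace_two {k : ℕ} (hk : 2 ≤ k) : IsPULBSpace 2 (skipOneAddTwo k) := by
  have hn : 2 ≤ 2 := le_rfl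
  obtain ⟨m, rfl⟩ : ∃ m, k = m + 2 := ⟨k - 2, by omega⟩
  have hm : (0 : ℝ) ≤ m := Nat.cast_nonneg m
  have hb : (0 : ℝ) * ((m : ℝ) + (2 : ℕ) - 1) < m + 1 := by linarith
  obtain ⟨x, β, hβ, hβ1, hP, hq, hxβ, -⟩ := exists_nodes_quasiGegenbauer hn m le_rfl hb
  have p2 := coeff_gegenbauer_self_pos hn (m + 2)
  have hrev := rev_eq_neg_of_strictMono hβ p2.ne' hq (eval_neg_quasiGegenbauer 2 m 0)
  obtain ⟨γ, hγ, hex⟩ := exists_positive_weights hn hb hβ.injective hP hq hxβ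
  rw [show quasiGegenbauer 2 m 0 = gegenbauer 2 (m + 2) by simp [quasiGegenbauer]] at hq hex
  have hex0 : ∀ g r : ℝ[X], r.natDegree < m + 2 → mean hn (gegenbauer 2 (m + 2) * g) = 0 →
      quadratureError hn β γ (gegenbauer 2 (m + 2) * g + r) = 0 := fun g r hr hg => by
    rw [quadratureError_apply, hex g r (by omega) hg, sub_self]
  have hex' : ∀ g : ℝ[X], mean hn (gegenbauer 2 (m + 2) * g) = 0 →
      quadratureError hn β γ (gegenbauer 2 (m + 2) * g) = 0 := fun g hg => by
    simpa using hex0 g 0 (by simp) hg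
  have hd : ∀ i, (gegenbauer 2 i).natDegree ≤ i := fun i => (natDegree_gegenbauer hn i).le
  have p3 := (coeff_gegenbauer_self_pos hn (m + 3)).ne'
  have p4 := (coeff_gegenbauer_self_pos hn (m + 4)).ne'
  refine ⟨m + 2, β, γ, isPositiveQuadrature_of_le_ker hn hβ hβ1 hγ ?_,
    hasLowerInterpolants_of_card_le hn (by omega) (by omega) le_rfl hβ hβ1 hrev⟩
  refine gegenbauerSpace_le_ker hn (by omega) _ (fun f hf => ?_)
    (u := gegenbauer 2 (m + 2) * gegenbauer 2 (m + 3)) ?_ ?_ ?_ ?_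
    (v := gegenbauer 2 (m + 2) * gegenbauer 2 (m + 4)) ?_ ?_ ?_ ?_
  · exact quadratureError_eq_zero_of_natDegree_lt hn (d := m + 2) p2.ne' hq hex0
      (fun g hg => mean_gegenbauer_mul_of_degree_lt hn hg) (by omega) (by omega)
  · exact natDegree_mul_le.trans (by have := hd (m + 2); have := hd (m + 3); omega)
  · refine coeff_eq_zero_of_comp_neg_X (d := 2 * m + 5) ?_ ⟨2 * m + 4, by ring⟩
    rw [mul_comp, gegenbauer_comp_neg_X, gegenbauer_comp_neg_X]
    ring
  · rw [show 2 * (m + 2) + 1 = m + 2 + (m + 3) by ring, coeff_mul_add_eq_of_natDegree_le (hd _) (hd _)]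
    exact mul_ne_zero p2.ne' p3
  · exact hex' _ (mean_gegenbauer_mul_of_ne hn (by omega))
  · exact natDegree_mul_le.trans (by have := hd (m + 2); have := hd (m + 4); omega)
  · have h1 := mean_mul_gegenbauer_of_natDegree_le_add_two hn (m := 2 * (m + 2))
      (p := gegenbauer 2 (m + 2) * gegenbauer 2 (m + 4))
      (natDegree_mul_le.trans (by have := hd (m + 2); have := hd (m + 4); omega))
    have h2 : (gegenbauer 2 (m + 2) * gegenbauer 2 (m + 4)).coeff (2 * (m + 2) + 2) =
        (gegenbauer 2 (m + 2)).coeff (m + 2) * (gegenbauer 2 (m + 4)).coeff (m + 4) := by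
      rw [show 2 * (m + 2) + 2 = m + 2 + (m + 4) by ring,
        coeff_mul_add_eq_of_natDegree_le (hd _) (hd _)]
    have h3 := coeff_mul_add_add_two (a := m) (b := m + 2) (hd (m + 2)) (hd (m + 4))
    have h4 := coeff_gegenbauer_sub_two hn m
    have h5 := coeff_gegenbauer_sub_two hn (m + 2)
    rw [show m + 2 + 2 = m + 4 by ring] at h3 h5
    rw [h4, h5, coeff_gegenbauer_succ_self hn (m + 1),
      show m + (m + 2) + 2 = 2 * (m + 2) by ring] at h3
    rw [h2, h3] at h1
    push_cast at h1
    -- Here the vanishing of the P_{2k} component becomes a rational identity between the ratios of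
    -- `coeff_gegenbauer_sub_two` at n = 2.
    refine (mul_eq_zero.1 (h1.trans ?_)).resolve_right (coeff_gegenbauer_self_pos hn _).ne'
    field_simp
    ring
  · rw [show 2 * (m + 2) + 2 = m + 2 + (m + 4) by ring, coeff_mul_add_eq_of_natDegree_le (hd _) (hd _)]
    exact mul_ne_zero p2.ne' p4
  · exact hex' _ (mean_gegenbauer_mul_of_ne hn (by omega))

/-! ### The PULB property in all dimensions, and the main theorem -/

theorem IsSkipPair.isPULBSpace {n : ℕ} {hn : 2 ≤ n} {m : ℕ} {b c : ℝ} (h : IsSkipPair hn m b c) :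
    IsPULBSpace n (skipOneAddTwo (m + 1)) := by
  obtain ⟨β, -, -, -, -, ⟨γ, hγ⟩, -, hL⟩ := h.exists_nodes
  exact ⟨m + 2, β, γ, hγ, hL⟩

theorem isPULBSpace_skipOneAddTwo {n k : ℕ} (hn : 2 ≤ n) (hk : 1 ≤ k) :
    IsPULBSpace n (skipOneAddTwo k) := by
  obtain ⟨m, rfl⟩ : ∃ m, k = m + 1 := ⟨k - 1, by omega⟩
  rcases eq_or_lt_of_le hn with rfl | hn3
  · rcases m with _ | m
    · exact (isSkipPair_two_zero hn).isPULBSpace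
    · exact isPULBSpace_two (by omega)
  · obtain ⟨⟨b, c⟩, ⟨hb, hc, h⟩, -⟩ := existsUnique_isSystemSolution (n := n) (k := m + 1) hn3 hk
    exact (isSkipPair_of_isSystemSolution hn hn3 hb hc h).isPULBSpace

end SkipOneAddTwo

end

theorem mainTheorem1 (n k : ℕ) (hn : 2 ≤ n) (hk : 1 ≤ k) :
    (Disjoint (degreeLT ℝ (2 * k))
        (Submodule.span ℝ {gegenbauer n (2 * k + 1), gegenbauer n (2 * k + 2)}) ∧
      degreeLT ℝ (2 * k) ⊔
          Submodule.span ℝ {gegenbauer n (2 * k + 1), gegenbauer n (2 * k + 2)} =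
        gegenbauerSpace n (skipOneAddTwo k)) ∧
    IsPULBSpace n (skipOneAddTwo k) ∧
    (3 ≤ n →
      (∃! bc : ℝ × ℝ, 0 < bc.1 ∧ bc.2 < 0 ∧ IsSystemSolution n k bc.1 bc.2) ∧
      ∀ b c : ℝ, 0 < b → c < 0 → IsSystemSolution n k b c →
        ∃ β : Fin (k + 1) → ℝ,
          StrictMono β ∧
          (∀ i, β i ∈ Ioo (-1 : ℝ) 1) ∧
          (∀ i, β i.rev = -β i) ∧
          gegenbauer n (k + 1) + C b * gegenbauer n (k - 1) =
            C ((ascPochhammer ℝ (k + 1)).eval ((n : ℝ) / 2 - 1) * 2 ^ (k + 1) /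
                (ascPochhammer ℝ (k + 1)).eval (2 * ((n : ℝ) / 2 - 1))) *
              ∏ i, (X - C (β i)) ∧
          (∃ γ : Fin (k + 1) → ℝ, IsPositiveQuadrature n (skipOneAddTwo k) β γ) ∧
          (∀ i ≤ k, 0 < gegenbauerCoeff n (∏ j : Fin k, (X - C (β j.castSucc))) i) ∧
          HasLowerInterpolants n (skipOneAddTwo k) β) := by
  refine ⟨⟨disjoint_degreeLT_span_gegenbauer hn (2 * k), gegenbauerSpace_skipOneAddTwo hn hk⟩,
    isPULBSpace_skipOneAddTwo hn hk, fun hn3 => ⟨existsUnique_isSystemSolution hn3 hk,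
      fun b c hb hc h => ?_⟩⟩
  obtain ⟨m, rfl⟩ : ∃ m, k = m + 1 := ⟨k - 1, by omega⟩
  obtain ⟨β, h1, h2, h3, h4, h5, h6, h7⟩ :=
    (isSkipPair_of_isSystemSolution hn hn3 hb hc h).exists_nodes
  refine ⟨β, h1, h2, h3, ?_, h5, h6, h7⟩
  rw [coeff_gegenbauer_self_mul_ascPochhammer hn3] at h4
  exact h4
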